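/- Theorem. Let $M$ be a connected smooth surface and let $X : M \to \mathbb{R}^3$ be a smooth immersion which is minimal, i.e. whose mean extrinsic curvature $K=\gamma^{ab}K_{ab}$ vanishes, where $\gamma_{ab}=\langle \partial_a X,\partial_b X\rangle$ and $K_{ab}=\langle n,\partial_a\partial_b X\rangle$ for a unit normal $n$. Suppose that the surface is invariant under a nontrivial smooth one-parameter group $(g_t)_{t\in\mathbb{R}}$ of isometries of $\mathbb{R}^3$ (such as a rotation about an axis combined with a translation along that axis), in the following sense: for every $p\in M$ there are $\varepsilon>0$ and a continuous curve $c:(-\varepsilon,\varepsilon)\to M$ with $c(0)=p$ and $X(c(t))=g_t(X(p))$ for $|t|<\varepsilon$. Then, up to an isometry of $\mathbb{R}^3$, $X$ is (a piece of) one of the following surfaces: 1. the plane $Y(u,v)=(u,v,0)$; 2. a helicoid $Y(\rho,\phi)=(\rho\cos\phi,\ \rho\sin\phi,\ \kappa\phi)$ with $\kappa>0$; 3. a catenoid $Y(\rho,\phi)=\left(c\cosh\frac{\rho}{c}\cos\phi,\ c\cosh\frac{\rho}{c}\sin\phi,\ \rho\right)$ with $c>0$; 4. a member of the associate family interpolating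 between the helicoid ($\lambda=1$) and the catenoid ($\lambda=0$) (Scherk's second surface, or helicatenoid), $$Y(\rho,\phi)=\begin{pmatrix}\lambda c\sinh\frac{\rho}{c}\sin\phi+\sqrt{1-\lambda^2}\,c\cosh\frac{\rho}{c}\cos\phi\\ -\lambda c\sinh\frac{\rho}{c}\cos\phi+\sqrt{1-\lambda^2}\,c\cosh\frac{\rho}{c}\sin\phi\\ \lambda c\phi+\sqrt{1-\lambda^2}\,\rho\end{pmatrix},\qquad c>0,\ 0<\lambda<1.$$ Precisely: there are one such parametrised surface $Y:\mathbb{R}^2\to\mathbb{R}^3$ and one isometry $\Phi$ of $\mathbb{R}^3$ such that every $p\in M$ has a neighbourhood on which $X=\Phi\circ Y\circ\psi$, where $\psi$ is a map to $\mathbb{R}^2$ that restricts to a diffeomorphism from a neighbourhood of $p$ onto an open subset of $\mathbb{R}^2$. -/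

import Mathlib

open scoped Manifold ContDiff

noncomputable section

/-- The parameter plane `ℝ²` with its Euclidean structure. -/
abbrev Plane2 : Type := EuclideanSpace ℝ (Fin 2)

/-- Euclidean three-space. -/
abbrev Space3 : Type := EuclideanSpace ℝ (Fin 3)

/-- The coordinate tangent vector `∂_a F (u)` of a parametrised surface `F`. -/
def coordTangent (F : Plane2 → Space3) (u : Plane2) (a : Fin 2) : Space3 :=
  fderiv ℝ F u (EuclideanSpace.single a 1)

/-- The second coordinate derivative `∂_a ∂_b F (u)`. -/
def coordSecond (F : Plane2 → Space3) (u : Plane2) (a b : Fin 2) : Space3 :=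
  fderiv ℝ (fun v => coordTangent F v b) u (EuclideanSpace.single a 1)

/-- The induced metric (first fundamental form) `γ_{ab} = ⟨∂_a F, ∂_b F⟩`. -/
def inducedMetric (F : Plane2 → Space3) (u : Plane2) : Matrix (Fin 2) (Fin 2) ℝ :=
  Matrix.of fun a b => inner ℝ (coordTangent F u a) (coordTangent F u b)

/-- `n` is a unit normal vector of the parametrised surface `F` at `u`. -/
def IsUnitNormal (F : Plane2 → Space3) (u : Plane2) (n : Space3) : Prop :=
  ‖n‖ = 1 ∧ ∀ a, inner ℝ n (coordTangent F u a) = 0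

/-- The extrinsic curvature (second fundamental form) `K_{ab} = ⟨n, ∂_a ∂_b F⟩`. -/
def extrinsicCurvature (F : Plane2 → Space3) (u : Plane2) (n : Space3) (a b : Fin 2) : ℝ :=
  inner ℝ n (coordSecond F u a b)

/-- The mean extrinsic curvature `K = γ^{ab} K_{ab}` with respect to `n`. -/
def meanCurvature (F : Plane2 → Space3) (u : Plane2) (n : Space3) : ℝ :=
  ∑ a, ∑ b, (inducedMetric F u)⁻¹ a b * extrinsicCurvature F u n a b

/-- A smooth immersed minimal surface `X : M → ℝ³`: `X` is smooth, its differential is injective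
everywhere, and in all local coordinates given by the charts of the surface `M` the mean
extrinsic curvature vanishes. -/
structure IsMinimalImmersion {M : Type*} [TopologicalSpace M] [ChartedSpace Plane2 M]
    (X : M → Space3) : Prop where
  smooth : ContMDiff (𝓡 2) (𝓡 3) ∞ X
  immersion : ∀ p, Function.Injective (mfderiv (𝓡 2) (𝓡 3) X p)
  minimal : ∀ e ∈ atlas Plane2 M, ∀ u ∈ e.target, ∀ n,
    IsUnitNormal (X ∘ e.symm) u n → meanCurvature (X ∘ e.symm) u n = 0

/-- A (smooth) one-parameter group of isometries of `ℝ³`. -/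
structure IsOneParameterIsometryGroup (g : ℝ → Space3 → Space3) : Prop where
  isometry : ∀ t, Isometry (g t)
  zero : ∀ x, g 0 x = x
  add : ∀ s t x, g (s + t) x = g s (g t x)
  smooth : ∀ x, ContDiff ℝ ∞ fun t => g t x

/-- The immersed surface `X : M → ℝ³` is invariant under the one-parameter group `g`: for small
times the motion of the point `X p` under `g` stays in the surface, i.e. it is the image of a curve
in `M` starting at `p`. Asking this only for small times admits pieces of surfaces; surfaces on
which the action of the whole group lifts are included. -/
def IsInvariantUnder {M : Type*} [TopologicalSpace M] (X : M → Space3)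
    (g : ℝ → Space3 → Space3) : Prop :=
  ∀ p, ∃ ε > 0, ∃ c : ℝ → M, ContinuousOn c (Set.Ioo (-ε) ε) ∧ c 0 = p ∧
    ∀ t ∈ Set.Ioo (-ε) ε, X (c t) = g t (X p)

/-- The plane `x₃ = 0`. -/
def planeParam (u : Plane2) : Space3 := !₂[u 0, u 1, 0]

/-- The helicoid, ruled by horizontal lines, that rises by `κ` per radian. -/
def helicoidParam (κ : ℝ) (u : Plane2) : Space3 :=
  !₂[u 0 * Real.cos (u 1), u 0 * Real.sin (u 1), κ * u 1]

/-- The catenoid with neck radius `c`. -/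
def catenoidParam (c : ℝ) (u : Plane2) : Space3 :=
  !₂[c * Real.cosh (u 0 / c) * Real.cos (u 1), c * Real.cosh (u 0 / c) * Real.sin (u 1), u 0]

/-- The surface with scale `c` and parameter `l` in the associate family of the catenoid (`l = 0`)
and the helicoid (`l = 1`): Scherk's second surface. -/
def scherkParam (c l : ℝ) (u : Plane2) : Space3 :=
  !₂[l * (c * Real.sinh (u 0 / c)) * Real.sin (u 1)
        + √(1 - l ^ 2) * (c * Real.cosh (u 0 / c)) * Real.cos (u 1),
     -(l * (c * Real.sinh (u 0 / c)) * Real.cos (u 1))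
        + √(1 - l ^ 2) * (c * Real.cosh (u 0 / c)) * Real.sin (u 1),
     l * c * u 1 + √(1 - l ^ 2) * u 0]

/-- The immersed surface `X : M → ℝ³` is (an immersed piece of) the surface parametrised by
`Y : ℝ² → ℝ³` up to one rigid motion `Φ` of `ℝ³`: around each point of `M` the map `X` is
`Φ ∘ Y` up to a local change of coordinates, with the same `Φ` for all points. -/
def IsPieceOf {M : Type*} [TopologicalSpace M] [ChartedSpace Plane2 M]
    (X : M → Space3) (Y : Plane2 → Space3) : Prop :=
  ∃ Φ : Space3 ≃ᵢ Space3, ∀ p : M, ∃ ψ : M → Plane2,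
    IsLocalDiffeomorphAt (𝓡 2) (𝓡 2) ∞ ψ p ∧ ∀ᶠ q in nhds p, X q = Φ (Y (ψ q))

end

/-! ### Vector algebra in three-space -/

/-! Differentiating the group at time 0 gives a Killing field V(x) = Ax + b with A skew. It is not
identically zero, and it is tangent to the surface. If A = 0, V is a translation field; otherwise an
isometry and a nonzero factor turn it into the screw field (-x₁, x₀, h) with h ≥ 0
(`exists_screw_normal_form`).

Tangency together with the symmetry of the shape operator gives dn(V) = An. Since the shape operator
of a minimal surface is also traceless, its value on the orthogonal direction n × V is then forced
to be -n × An (`exists_killing_frame`). For a translation this makes n constant, so the surface is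
planar. For a screw field dn becomes a function of n alone, and β = n₀F₀ + n₁F₁ is a first integral
(`horizontal_support_eq`).

If h = β = 0, the normal is vertical and the surface is a horizontal plane. Otherwise n is never
vertical, and the Mercator coordinates (σ, φ) of n on the sphere serve as local coordinates of the
surface. The relation ⟨n, V⟩ = 0 and the value of β determine the horizontal part of F, while F₂ -
hφ - βσ is constant (`exists_screwParam_lift`). Thus F is h times a helicoid plus β times a
catenoid.

Normals exist only chart by chart and up to sign. A clopen argument (`forall_of_locally_propagates`)
shows that the same constants serve on all of M; `isPieceOf_of_screwParam` then reads off the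
standard forms. -/

/-- The cross product on Euclidean three-space. -/
def cross (x y : Space3) : Space3 :=
  !₂[x 1 * y 2 - x 2 * y 1, x 2 * y 0 - x 0 * y 2, x 0 * y 1 - x 1 * y 0]

@[simp] theorem cross_apply_zero (x y : Space3) : cross x y 0 = x 1 * y 2 - x 2 * y 1 := rfl
@[simp] theorem cross_apply_one (x y : Space3) : cross x y 1 = x 2 * y 0 - x 0 * y 2 := rfl
@[simp] theorem cross_apply_two (x y : Space3) : cross x y 2 = x 0 * y 1 - x 1 * y 0 := rfl

theorem inner_space3 (x y : Space3) : inner ℝ x y = x 0 * y 0 + x 1 * y 1 + x 2 * y 2 := by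
  simp [PiLp.inner_apply, Fin.sum_univ_three, mul_comm]

theorem norm_sq_space3 (x : Space3) : ‖x‖ ^ 2 = x 0 ^ 2 + x 1 ^ 2 + x 2 ^ 2 := by
  rw [← real_inner_self_eq_norm_sq, inner_space3]; ring

theorem space3_ext {x y : Space3} (h0 : x 0 = y 0) (h1 : x 1 = y 1) (h2 : x 2 = y 2) : x = y := by
  ext i; fin_cases i <;> assumption

theorem plane2_ext {x y : Plane2} (h0 : x 0 = y 0) (h1 : x 1 = y 1) : x = y := by
  ext i; fin_cases i <;> assumption

theorem inner_cross_left (x y : Space3) : inner ℝ x (cross x y) = 0 := by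
  simp only [inner_space3, cross_apply_zero, cross_apply_one, cross_apply_two]; ring

theorem inner_cross_right (x y : Space3) : inner ℝ y (cross x y) = 0 := by
  simp only [inner_space3, cross_apply_zero, cross_apply_one, cross_apply_two]; ring

theorem inner_cross_cross (x y z : Space3) :
    inner ℝ (cross x y) (cross x z) = ‖x‖ ^ 2 * inner ℝ y z - inner ℝ x y * inner ℝ x z := by
  rw [norm_sq_space3]
  simp only [inner_space3, cross_apply_zero, cross_apply_one, cross_apply_two]; ring

theorem inner_cross_swap (x y z : Space3) :
    inner ℝ (cross x y) z = -inner ℝ y (cross x z) := by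
  simp only [inner_space3, cross_apply_zero, cross_apply_one, cross_apply_two]; ring

/-- A vector orthogonal to `n`, `V` and `n × V` vanishes if `n` is a unit vector, `V ≠ 0`
and `n ⟂ V`. -/
theorem eq_zero_of_inner_frame_eq_zero {n V y : Space3} (hn : ‖n‖ = 1) (hV : V ≠ 0)
    (hnV : inner ℝ n V = 0) (h1 : inner ℝ n y = 0) (h2 : inner ℝ V y = 0)
    (h3 : inner ℝ (cross n V) y = 0) : y = 0 := by
  have hn2 : n 0 ^ 2 + n 1 ^ 2 + n 2 ^ 2 = 1 := by rw [← norm_sq_space3, hn, one_pow]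
  have hV2 : V 0 ^ 2 + V 1 ^ 2 + V 2 ^ 2 ≠ 0 := by
    rw [← norm_sq_space3]; positivity
  let A : Matrix (Fin 3) (Fin 3) ℝ := Matrix.of ![n.ofLp, V.ofLp, (cross n V).ofLp]
  -- The determinant is |n × V|² = |n|²|V|² - ⟨n, V⟩², which here is |V|².
  have hdet : A.det = V 0 ^ 2 + V 1 ^ 2 + V 2 ^ 2 := by
    rw [inner_space3] at hnV
    simp [A, Matrix.det_fin_three]
    linear_combination (V 0 ^ 2 + V 1 ^ 2 + V 2 ^ 2) * hn2
      - (n 0 * V 0 + n 1 * V 1 + n 2 * V 2) * hnV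
  have hmul : A.mulVec y.ofLp = 0 := by
    rw [inner_space3] at h1 h2 h3
    ext i
    fin_cases i
    · simpa [A, Matrix.mulVec, dotProduct, Fin.sum_univ_three] using h1
    · simpa [A, Matrix.mulVec, dotProduct, Fin.sum_univ_three] using h2
    · simpa [A, Matrix.mulVec, dotProduct, Fin.sum_univ_three] using h3
  have := Matrix.eq_zero_of_mulVec_eq_zero (by rw [hdet]; exact hV2) hmul
  ext i; exact congrFun this i

/-! ### Immersed minimal patches with a unit normal field -/

/-- A smooth immersion `F` of an open subset `B` of the plane with a smooth unit normal field `n`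
whose shape operator is self-adjoint and traceless. -/
structure IsMinimalPatch (F n : Plane2 → Space3) (B : Set Plane2) : Prop where
  isOpen : IsOpen B
  contDiffOn : ContDiffOn ℝ ∞ F B
  contDiffOn_normal : ContDiffOn ℝ ∞ n B
  injective : ∀ u ∈ B, Function.Injective (fderiv ℝ F u)
  norm_eq_one : ∀ u ∈ B, ‖n u‖ = 1
  inner_fderiv : ∀ u ∈ B, ∀ a, inner ℝ (n u) (fderiv ℝ F u a) = 0
  symm : ∀ u ∈ B, ∀ a b, inner ℝ (fderiv ℝ n u a) (fderiv ℝ F u b) =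
    inner ℝ (fderiv ℝ n u b) (fderiv ℝ F u a)
  trace : ∀ u ∈ B, ∀ a b, ‖fderiv ℝ F u a‖ = ‖fderiv ℝ F u b‖ →
    inner ℝ (fderiv ℝ F u a) (fderiv ℝ F u b) = 0 →
    inner ℝ (fderiv ℝ n u a) (fderiv ℝ F u a) + inner ℝ (fderiv ℝ n u b) (fderiv ℝ F u b) = 0

namespace IsMinimalPatch

variable {F n : Plane2 → Space3} {B : Set Plane2}

theorem mono (hp : IsMinimalPatch F n B) {U : Set Plane2} (hU : IsOpen U) (hUB : U ⊆ B) :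
    IsMinimalPatch F n U where
  isOpen := hU
  contDiffOn := hp.contDiffOn.mono hUB
  contDiffOn_normal := hp.contDiffOn_normal.mono hUB
  injective u hu := hp.injective u (hUB hu)
  norm_eq_one u hu := hp.norm_eq_one u (hUB hu)
  inner_fderiv u hu := hp.inner_fderiv u (hUB hu)
  symm u hu := hp.symm u (hUB hu)
  trace u hu := hp.trace u (hUB hu)

/-- Normals chosen in different charts agree only up to sign, so later arguments must be free to
flip one. -/
theorem neg (hp : IsMinimalPatch F n B) : IsMinimalPatch F (fun u => -n u) B where
  isOpen := hp.isOpen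
  contDiffOn := hp.contDiffOn
  contDiffOn_normal := hp.contDiffOn_normal.neg
  injective := hp.injective
  norm_eq_one u hu := by rw [norm_neg]; exact hp.norm_eq_one u hu
  inner_fderiv u hu a := by rw [inner_neg_left, hp.inner_fderiv u hu, neg_zero]
  symm u hu a b := by
    simp only [fderiv_fun_neg, neg_apply, inner_neg_left, hp.symm u hu a b]
  trace u hu a b h1 h2 := by
    have := hp.trace u hu a b h1 h2
    simp only [fderiv_fun_neg, neg_apply, inner_neg_left]
    linarith

theorem hasFDerivAt (hp : IsMinimalPatch F n B) {u : Plane2} (hu : u ∈ B) :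
    HasFDerivAt F (fderiv ℝ F u) u :=
  ((hp.contDiffOn.contDiffAt (hp.isOpen.mem_nhds hu)).differentiableAt (by simp)).hasFDerivAt

theorem hasFDerivAt_normal (hp : IsMinimalPatch F n B) {u : Plane2} (hu : u ∈ B) :
    HasFDerivAt n (fderiv ℝ n u) u :=
  ((hp.contDiffOn_normal.contDiffAt (hp.isOpen.mem_nhds hu)).differentiableAt
    (by simp)).hasFDerivAt

/-- Every vector orthogonal to the normal is tangent. -/
theorem exists_fderiv_eq (hp : IsMinimalPatch F n B) {u : Plane2} (hu : u ∈ B) {y : Space3}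
    (hy : inner ℝ (n u) y = 0) : ∃ a, fderiv ℝ F u a = y := by
  have hn0 : n u ≠ 0 := by
    intro h; have := hp.norm_eq_one u hu; rw [h, norm_zero] at this; exact zero_ne_one this
  have hle : (fderiv ℝ F u).toLinearMap.range ≤ (Submodule.span ℝ {n u})ᗮ := by
    rintro _ ⟨a, rfl⟩
    rw [Submodule.mem_orthogonal_singleton_iff_inner_right]
    exact hp.inner_fderiv u hu a
  have hr : Module.finrank ℝ (fderiv ℝ F u).toLinearMap.range = 2 := by
    rw [LinearMap.finrank_range_of_inj (hp.injective u hu)]; simp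
  have ho : Module.finrank ℝ (Submodule.span ℝ {n u})ᗮ = 2 := by
    have h1 := Submodule.finrank_add_finrank_orthogonal (Submodule.span ℝ {n u})
    rw [finrank_span_singleton hn0] at h1
    simp at h1; omega
  have := Submodule.eq_of_le_of_finrank_eq hle (hr.trans ho.symm)
  have hy' : y ∈ (fderiv ℝ F u).toLinearMap.range := by
    rw [this, Submodule.mem_orthogonal_singleton_iff_inner_right]; exact hy
  exact hy'

theorem inner_fderiv_normal (hp : IsMinimalPatch F n B) {u : Plane2} (hu : u ∈ B) (a : Plane2) :
    inner ℝ (n u) (fderiv ℝ n u a) = 0 := by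
  have h1 := ((hp.hasFDerivAt_normal hu).inner ℝ (hp.hasFDerivAt_normal hu))
  have h2 : (fun t => inner ℝ (n t) (n t)) =ᶠ[nhds u] fun _ => (1 : ℝ) := by
    filter_upwards [hp.isOpen.mem_nhds hu] with t ht
    rw [real_inner_self_eq_norm_sq, hp.norm_eq_one t ht, one_pow]
  have h3 := h1.unique ((hasFDerivAt_const (1 : ℝ) u).congr_of_eventuallyEq h2)
  have h4 := DFunLike.congr_fun h3 a
  simp [fderivInnerCLM_apply, real_inner_comm] at h4
  linarith [real_inner_comm (n u) (fderiv ℝ n u a)]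

/-- The derivatives of the normal field of a minimal surface that is tangent to a Killing field
`x ↦ A x + b`, in the orthogonal frame given by the Killing field. -/
theorem exists_killing_frame (hp : IsMinimalPatch F n B) {A : Space3 →L[ℝ] Space3} {b : Space3}
    (hA : ∀ x y, inner ℝ (A x) y = -inner ℝ x (A y))
    (htan : ∀ u ∈ B, ∃ v, fderiv ℝ F u v = A (F u) + b) {u : Plane2} (hu : u ∈ B)
    (hV : A (F u) + b ≠ 0) :
    ∃ v w, fderiv ℝ F u v = A (F u) + b ∧ fderiv ℝ F u w = cross (n u) (A (F u) + b) ∧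
      fderiv ℝ n u v = A (n u) ∧ fderiv ℝ n u w = -cross (n u) (A (n u)) ∧
      ∀ a, ∃ α β : ℝ, a = α • v + β • w := by
  obtain ⟨v, hv⟩ := htan u hu
  set V := A (F u) + b with hVdef
  have hn := hp.norm_eq_one u hu
  have hnV : inner ℝ (n u) V = 0 := by rw [← hv]; exact hp.inner_fderiv u hu v
  obtain ⟨w, hw⟩ := hp.exists_fderiv_eq hu (inner_cross_left (n u) V)
  have hAn : inner ℝ (n u) (A (n u)) = 0 := by
    have := hA (n u) (n u); rw [real_inner_comm] at this; linarith
  -- Differentiating ⟨n, AF + b⟩ = 0 gives ⟨dn a, V⟩ = -⟨n, A(dF a)⟩, and A is skew.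
  have hdn : ∀ a, inner ℝ (fderiv ℝ n u a) V = inner ℝ (A (n u)) (fderiv ℝ F u a) := by
    intro a
    have h1 := (hp.hasFDerivAt_normal hu).inner ℝ
      ((A.hasFDerivAt.comp u (hp.hasFDerivAt hu)).add_const b)
    have h2 : (fun t => inner ℝ (n t) ((A ∘ F) t + b)) =ᶠ[nhds u] fun _ => (0 : ℝ) := by
      filter_upwards [hp.isOpen.mem_nhds hu] with t ht
      obtain ⟨v', hv'⟩ := htan t ht
      rw [Function.comp_apply, ← hv']
      exact hp.inner_fderiv t ht v'
    have h3 := h1.unique ((hasFDerivAt_const (0 : ℝ) u).congr_of_eventuallyEq h2)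
    have h4 := DFunLike.congr_fun h3 a
    simp [fderivInnerCLM_apply] at h4
    rw [hA]
    linarith
  have hdnv : fderiv ℝ n u v = A (n u) := by
    rw [← sub_eq_zero]
    -- By symmetry of the shape operator ⟨dn v, dF a⟩ = ⟨dn a, V⟩, which `hdn` evaluates.
    have key : ∀ a, inner ℝ (fderiv ℝ F u a) (fderiv ℝ n u v - A (n u)) = 0 := by
      intro a
      rw [inner_sub_right, real_inner_comm, hp.symm u hu, hv, hdn,
        real_inner_comm (A (n u)), sub_self]
    refine eq_zero_of_inner_frame_eq_zero hn hV hnV ?_ (hv ▸ key v) (hw ▸ key w)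
    rw [inner_sub_right, hp.inner_fderiv_normal hu, hAn, sub_zero]
  -- The V-component again comes from `hdn`. The component along n × V comes from the vanishing
  -- trace, since V and n × V are orthogonal of equal length.
  have hdnw : fderiv ℝ n u w = -cross (n u) (A (n u)) := by
    rw [← sub_eq_zero]
    have hsq : inner ℝ (cross (n u) V) (cross (n u) V) = inner ℝ V V := by
      rw [inner_cross_cross, hn, hnV]; ring
    refine eq_zero_of_inner_frame_eq_zero hn hV hnV ?_ ?_ ?_
    · rw [inner_sub_right, hp.inner_fderiv_normal hu, inner_neg_right, inner_cross_left]; simp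
    · rw [inner_sub_right, real_inner_comm, hdn, hw, inner_neg_right, real_inner_comm,
        inner_cross_swap]
      ring
    · have htr := hp.trace u hu v w (by
        rw [hv, hw]
        have := hsq
        rw [real_inner_self_eq_norm_sq, real_inner_self_eq_norm_sq] at this
        exact ((sq_eq_sq₀ (norm_nonneg _) (norm_nonneg _)).1 this).symm)
        (by rw [hv, hw, inner_cross_right])
      rw [hv, hw, hdnv] at htr
      rw [inner_sub_right, inner_neg_right, inner_cross_cross, hn, hnV,
        real_inner_comm (fderiv ℝ n u w)]
      rw [real_inner_comm] at htr
      linarith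
  refine ⟨v, w, hv, hw, hdnv, hdnw, fun a => ?_⟩
  have hVV : inner ℝ V V ≠ 0 := by simpa using hV
  -- These are the coordinates of dF a in the orthogonal basis V, n × V of the tangent plane;
  -- injectivity of dF carries the expansion back to a.
  refine ⟨inner ℝ V (fderiv ℝ F u a) / inner ℝ V V,
    inner ℝ (cross (n u) V) (fderiv ℝ F u a) / inner ℝ V V, hp.injective u hu ?_⟩
  rw [← sub_eq_zero, map_add, map_smul, map_smul, hv, hw]
  have hsq : inner ℝ (cross (n u) V) (cross (n u) V) = inner ℝ V V := by
    rw [inner_cross_cross, hn, hnV]; ring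
  refine eq_zero_of_inner_frame_eq_zero hn hV hnV ?_ ?_ ?_
  · simp [inner_sub_right, inner_add_right, inner_smul_right, hp.inner_fderiv u hu, hnV,
      inner_cross_left, -inner_self_eq_norm_sq_to_K]
  · rw [inner_sub_right, inner_add_right, inner_smul_right, inner_smul_right, inner_cross_right,
      div_mul_cancel₀ _ hVV]
    ring
  · rw [inner_sub_right, inner_add_right, inner_smul_right, inner_smul_right, hsq,
      div_mul_cancel₀ _ hVV, real_inner_comm V (cross (n u) V), inner_cross_right]
    ring

end IsMinimalPatch

/-! ### Patches tangent to a translation or screw motion field -/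

theorem HasFDerivAt.space3_coord {G : Plane2 → Space3} {G' : Plane2 →L[ℝ] Space3} {u : Plane2}
    (h : HasFDerivAt G G' u) (i : Fin 3) :
    HasFDerivAt (fun t => G t i) ((EuclideanSpace.proj i : Space3 →L[ℝ] ℝ).comp G') u :=
  (EuclideanSpace.proj i : Space3 →L[ℝ] ℝ).hasFDerivAt.comp u h

theorem HasFDerivAt.plane2_coord {G : Plane2 → Plane2} {G' : Plane2 →L[ℝ] Plane2} {u : Plane2}
    (h : HasFDerivAt G G' u) (i : Fin 2) :
    HasFDerivAt (fun t => G t i) ((EuclideanSpace.proj i : Plane2 →L[ℝ] ℝ).comp G') u :=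
  (EuclideanSpace.proj i : Plane2 →L[ℝ] ℝ).hasFDerivAt.comp u h

/-- The infinitesimal rotation about the third axis. -/
noncomputable def rotGen : Space3 →L[ℝ] Space3 :=
  LinearMap.toContinuousLinearMap
    { toFun := fun x => !₂[-x 1, x 0, 0]
      map_add' := fun x y => by
        refine space3_ext ?_ ?_ ?_ <;> simp [add_comm]
      map_smul' := fun c x => by
        refine space3_ext ?_ ?_ ?_ <;> simp }

@[simp] theorem rotGen_apply (x : Space3) : rotGen x = !₂[-x 1, x 0, 0] := rfl

theorem inner_rotGen (x y : Space3) : inner ℝ (rotGen x) y = -inner ℝ x (rotGen y) := by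
  simp only [inner_space3, rotGen_apply]
  simp

/-- The generator of the screw motion of pitch `h` about the third axis. -/
noncomputable def screwField (h : ℝ) (x : Space3) : Space3 := rotGen x + !₂[0, 0, h]

@[simp] theorem screwField_zero (h : ℝ) (x : Space3) : screwField h x 0 = -x 1 := by
  simp [screwField]
@[simp] theorem screwField_one (h : ℝ) (x : Space3) : screwField h x 1 = x 0 := by
  simp [screwField]
@[simp] theorem screwField_two (h : ℝ) (x : Space3) : screwField h x 2 = h := by
  simp [screwField]

namespace IsMinimalPatch

variable {F n : Plane2 → Space3} {B : Set Plane2}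

theorem normal_eq_of_fderiv_eq_zero (hp : IsMinimalPatch F n B) (hB : IsPreconnected B)
    (h : ∀ u ∈ B, fderiv ℝ n u = 0) {u q : Plane2} (hu : u ∈ B) (hq : q ∈ B) : n u = n q :=
  hp.isOpen.is_const_of_fderiv_eq_zero hB (hp.contDiffOn_normal.differentiableOn (by simp))
    h hu hq

theorem inner_eq_of_normal_eq (hp : IsMinimalPatch F n B) (hB : IsPreconnected B)
    {ν : Space3} (h : ∀ u ∈ B, n u = ν) {u q : Plane2} (hu : u ∈ B) (hq : q ∈ B) :
    inner ℝ ν (F u) = inner ℝ ν (F q) := by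
  have hd : ∀ t ∈ B, HasFDerivAt (fun t => inner ℝ ν (F t)) (0 : Plane2 →L[ℝ] ℝ) t := by
    intro t ht
    have h1 := (hasFDerivAt_const ν t).inner ℝ (hp.hasFDerivAt ht)
    convert! h1 using 1
    ext1 a
    have := hp.inner_fderiv t ht a
    rw [h t ht] at this
    simp [fderivInnerCLM_apply, this]
  exact hp.isOpen.is_const_of_fderiv_eq_zero (f := fun t => inner ℝ ν (F t)) hB
    (fun t ht => (hd t ht).differentiableAt.differentiableWithinAt)
    (fun t ht => (hd t ht).fderiv) hu hq

/-- A minimal patch tangent to a constant field has constant normal. -/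
theorem normal_eq_of_translation (hp : IsMinimalPatch F n B) (hB : IsPreconnected B)
    {b : Space3} (hb : b ≠ 0) (htan : ∀ u ∈ B, ∃ v, fderiv ℝ F u v = b)
    {u q : Plane2} (hu : u ∈ B) (hq : q ∈ B) : n u = n q := by
  refine hp.normal_eq_of_fderiv_eq_zero hB (fun t ht => ?_) hu hq
  obtain ⟨v, w, -, -, h1, h2, h3⟩ := hp.exists_killing_frame (A := 0) (b := b) (by simp)
    (by simpa using htan) ht (by simpa using hb)
  have hz : cross (n t) 0 = 0 := by refine space3_ext ?_ ?_ ?_ <;> simp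
  ext1 a
  obtain ⟨α, β, rfl⟩ := h3 a
  simp [map_add, h1, h2, hz]

/-- For an infinitesimal rotation the equations for dn close up: along v the normal turns about the
axis, along w it moves along a meridian of the sphere, and the position no longer enters. -/
theorem exists_screw_frame (hp : IsMinimalPatch F n B) {h : ℝ}
    (htan : ∀ u ∈ B, ∃ v, fderiv ℝ F u v = screwField h (F u)) {u : Plane2} (hu : u ∈ B)
    (hV : screwField h (F u) ≠ 0) :
    ∃ v w, fderiv ℝ F u v = screwField h (F u) ∧
      fderiv ℝ F u w = cross (n u) (screwField h (F u)) ∧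
      fderiv ℝ n u v = !₂[-n u 1, n u 0, 0] ∧
      fderiv ℝ n u w = !₂[n u 2 * n u 0, n u 2 * n u 1, -(n u 0 ^ 2 + n u 1 ^ 2)] ∧
      ∀ a, ∃ α β : ℝ, a = α • v + β • w := by
  obtain ⟨v, w, h1, h2, h3, h4, h5⟩ :=
    hp.exists_killing_frame (A := rotGen) (b := !₂[0, 0, h]) inner_rotGen htan hu hV
  refine ⟨v, w, h1, h2, h3, ?_, h5⟩
  rw [h4]
  refine space3_ext ?_ ?_ ?_ <;> simp
  ring

/-- The screw motion field does not vanish on an open subset of an immersed surface. -/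
theorem not_eventually_screwField_eq_zero (hp : IsMinimalPatch F n B) {h : ℝ} {u : Plane2}
    (hu : u ∈ B) : ¬ ∀ᶠ t in nhds u, screwField h (F t) = 0 := by
  intro hz
  have hi := hp.injective u hu
  -- The field can vanish only on the axis, so the horizontal coordinates of F are constant near u
  -- and dF would have rank at most one.
  have hc : ∀ i : Fin 3, i ≠ 2 → ∀ a, fderiv ℝ F u a i = 0 := by
    intro i hi2 a
    have h1 := (hp.hasFDerivAt hu).space3_coord i
    have h2 : (fun t => F t i) =ᶠ[nhds u] fun _ => (0 : ℝ) := by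
      filter_upwards [hz] with t ht
      have e0 := congrArg (fun x : Space3 => x 0) ht
      have e1 := congrArg (fun x : Space3 => x 1) ht
      simp at e0 e1
      fin_cases i
      · exact e1
      · exact e0
      · exact absurd rfl hi2
    exact DFunLike.congr_fun
      (h1.unique ((hasFDerivAt_const (0 : ℝ) u).congr_of_eventuallyEq h2)) a
  have hker : ∀ a, fderiv ℝ F u a 2 = 0 → a = 0 := by
    intro a ha
    apply hi
    rw [map_zero]
    exact space3_ext (hc 0 (by decide) a) (hc 1 (by decide) a) ha
  have hmain : ∀ a b : Plane2, a = 0 ∨ b = 0 ∨ ∃ c : ℝ, a = c • b := by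
    intro a b
    by_cases hb : fderiv ℝ F u b 2 = 0
    · exact Or.inr (Or.inl (hker b hb))
    · refine Or.inr (Or.inr ⟨fderiv ℝ F u a 2 / fderiv ℝ F u b 2, ?_⟩)
      rw [← sub_eq_zero]
      apply hker
      rw [map_sub, map_smul]
      simp [div_mul_cancel₀ _ hb]
  rcases hmain (EuclideanSpace.single 0 1) (EuclideanSpace.single 1 1) with h | h | ⟨c, h⟩
  · simpa using congrArg (fun x : Plane2 => x 0) h
  · simpa using congrArg (fun x : Plane2 => x 1) h
  · simpa using congrArg (fun x : Plane2 => x 0) h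

/-- A continuously differentiable function on a patch whose derivative vanishes where the screw
motion field does not vanish is constant. -/
theorem eq_of_fderiv_eq_zero_of_screwField_ne_zero {E : Type*} [NormedAddCommGroup E]
    [NormedSpace ℝ E] (hp : IsMinimalPatch F n B) (hB : IsPreconnected B) {h : ℝ}
    {χ : Plane2 → E} (hχ : ContDiffOn ℝ ∞ χ B)
    (hd : ∀ u ∈ B, screwField h (F u) ≠ 0 → fderiv ℝ χ u = 0) {u q : Plane2}
    (hu : u ∈ B) (hq : q ∈ B) : χ u = χ q := by
  refine hp.isOpen.is_const_of_fderiv_eq_zero hB (hχ.differentiableOn (by simp))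
    (fun t ht => ?_) hu hq
  by_contra hne
  refine hp.not_eventually_screwField_eq_zero (h := h) ht ?_
  -- A nonzero derivative at t stays nonzero nearby, so the field would vanish on an open set.
  have hcont : ContinuousAt (fderiv ℝ χ) t :=
    (hχ.continuousOn_fderiv_of_isOpen hp.isOpen (by simp)).continuousAt (hp.isOpen.mem_nhds ht)
  filter_upwards [hcont.eventually_ne hne, hp.isOpen.mem_nhds ht] with r hr hrB
  by_contra hV
  exact hr (hd r hrB hV)

/-- The first integral: the horizontal part of the position paired with the normal. -/
theorem horizontal_support_eq (hp : IsMinimalPatch F n B) (hB : IsPreconnected B) {h : ℝ}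
    (htan : ∀ u ∈ B, ∃ v, fderiv ℝ F u v = screwField h (F u)) {u q : Plane2}
    (hu : u ∈ B) (hq : q ∈ B) :
    n u 0 * F u 0 + n u 1 * F u 1 = n q 0 * F q 0 + n q 1 * F q 1 := by
  have hF := contDiffOn_euclidean.1 hp.contDiffOn
  have hn := contDiffOn_euclidean.1 hp.contDiffOn_normal
  refine hp.eq_of_fderiv_eq_zero_of_screwField_ne_zero (h := h)
    (χ := fun u => n u 0 * F u 0 + n u 1 * F u 1) hB
    (((hn 0).mul (hF 0)).add ((hn 1).mul (hF 1))) (fun t ht hV => ?_) hu hq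
  obtain ⟨v, w, h1, h2, h3, h4, h5⟩ := hp.exists_screw_frame htan ht hV
  have hd := (((hp.hasFDerivAt_normal ht).space3_coord 0).mul
    ((hp.hasFDerivAt ht).space3_coord 0)).add
    (((hp.hasFDerivAt_normal ht).space3_coord 1).mul ((hp.hasFDerivAt ht).space3_coord 1))
  have hd' : fderiv ℝ (fun u => n u 0 * F u 0 + n u 1 * F u 1) t = _ := hd.fderiv
  rw [hd']
  ext1 a
  obtain ⟨α, β, rfl⟩ := h5 a
  -- Along v the horizontal parts of n and F rotate together. Along w, dn contributes n₂(n₀F₀ +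
  -- n₁F₁) and dF contributes its negative.
  simp [map_add, h1, h2, h3, h4]
  ring

/-- If the first integral of a surface tangent to a rotation field vanishes, the normal is
vertical off the axis. -/
theorem normal_vertical_of_horizontal_support_eq_zero (hp : IsMinimalPatch F n B)
    (htan : ∀ u ∈ B, ∃ v, fderiv ℝ F u v = screwField 0 (F u)) {t : Plane2} (ht : t ∈ B)
    (hβ : n t 0 * F t 0 + n t 1 * F t 1 = 0) (hV : screwField 0 (F t) ≠ 0) :
    n t 0 = 0 ∧ n t 1 = 0 := by
  obtain ⟨v, h1⟩ := htan t ht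
  have e2 := hp.inner_fderiv t ht v
  rw [h1, inner_space3] at e2
  simp at e2
  have hne : F t 0 ^ 2 + F t 1 ^ 2 ≠ 0 := by
    intro h0
    apply hV
    have a0 : F t 0 = 0 := by nlinarith [sq_nonneg (F t 0), sq_nonneg (F t 1)]
    have a1 : F t 1 = 0 := by nlinarith [sq_nonneg (F t 0), sq_nonneg (F t 1)]
    refine space3_ext ?_ ?_ ?_ <;> simp [a0, a1]
  -- The equations `hβ` and `e2` are linear in (n₀, n₁) with determinant F₀² + F₁², up to sign.
  constructor
  · apply mul_right_cancel₀ hne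
    linear_combination F t 0 * hβ - F t 1 * e2
  · apply mul_right_cancel₀ hne
    linear_combination F t 1 * hβ + F t 0 * e2

/-- If the first integral vanishes and the axis field is a rotation, the surface is horizontal. -/
theorem normal_eq_of_horizontal_support_eq_zero (hp : IsMinimalPatch F n B)
    (hB : IsPreconnected B)
    (htan : ∀ u ∈ B, ∃ v, fderiv ℝ F u v = screwField 0 (F u))
    (hβ : ∀ u ∈ B, n u 0 * F u 0 + n u 1 * F u 1 = 0) {u q : Plane2}
    (hu : u ∈ B) (hq : q ∈ B) : n u = n q := by
  refine hp.eq_of_fderiv_eq_zero_of_screwField_ne_zero (h := 0) hB hp.contDiffOn_normal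
    (fun t ht hV => ?_) hu hq
  obtain ⟨v, w, h1, h2, h3, h4, h5⟩ := hp.exists_screw_frame htan ht hV
  obtain ⟨n0, n1⟩ := hp.normal_vertical_of_horizontal_support_eq_zero htan ht (hβ t ht) hV
  ext1 a
  obtain ⟨α, β, rfl⟩ := h5 a
  rw [map_add, map_smul, map_smul, h3, h4]
  refine space3_ext ?_ ?_ ?_ <;> simp [n0, n1]

end IsMinimalPatch

/-! ### Integration of the structure equations -/

/-- The unit normal of the surfaces in the associate family of the catenoid, in conformal
coordinates. -/
noncomputable def normalParam (s : Plane2) : Space3 :=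
  !₂[Real.cos (s 1) / Real.cosh (s 0), Real.sin (s 1) / Real.cosh (s 0),
    -(Real.sinh (s 0) / Real.cosh (s 0))]

/-- The linear combination of helicoid (coefficient `h`) and catenoid (coefficient `b`) in
conformal coordinates, shifted by `d` along the axis. -/
noncomputable def screwParam (h b d : ℝ) (s : Plane2) : Space3 :=
  !₂[b * Real.cosh (s 0) * Real.cos (s 1) + h * Real.sinh (s 0) * Real.sin (s 1),
    b * Real.cosh (s 0) * Real.sin (s 1) - h * Real.sinh (s 0) * Real.cos (s 1),
    h * s 1 + b * s 0 + d]

/-- This identifies the catenoid coefficient with the first integral, so it can be read off at a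
single point. -/
theorem horizontal_support_screwParam (h b d : ℝ) (s : Plane2) :
    normalParam s 0 * screwParam h b d s 0 + normalParam s 1 * screwParam h b d s 1 = b := by
  have hc := (Real.cosh_pos (s 0)).ne'
  simp [normalParam, screwParam]
  field_simp
  linear_combination (Real.cosh (s 0) * b) * (Real.sin_sq_add_cos_sq (s 1))

/-- A unit vector that is not vertical is the normal at some parameter. -/
theorem exists_normalParam_eq {ν : Space3} (hν : ‖ν‖ = 1) (hh : ν 0 ^ 2 + ν 1 ^ 2 ≠ 0) :
    ∃ s, normalParam s = ν := by
  have h1 : ν 0 ^ 2 + ν 1 ^ 2 + ν 2 ^ 2 = 1 := by rw [← norm_sq_space3, hν, one_pow]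
  have hpos : 0 < ν 0 ^ 2 + ν 1 ^ 2 := lt_of_le_of_ne (by positivity) (Ne.symm hh)
  set r := √(ν 0 ^ 2 + ν 1 ^ 2) with hr
  have hr0 : 0 < r := Real.sqrt_pos.2 hpos
  have hr2 : r ^ 2 = ν 0 ^ 2 + ν 1 ^ 2 := Real.sq_sqrt hpos.le
  -- The third coordinate of the normal requires sinh s₀ = -ν₂ / r; then cosh s₀ = 1 / r because r²
  -- + ν₂² = 1.
  have hC : Real.cosh (Real.arsinh (-ν 2 / r)) = 1 / r := by
    rw [Real.cosh_arsinh, Real.sqrt_eq_iff_mul_self_eq (by positivity) (by positivity)]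
    field_simp
    linear_combination h1 + hr2
  have hz : (⟨ν 0, ν 1⟩ : ℂ) ≠ 0 := by
    intro h0
    have a0 := congrArg Complex.re h0
    have a1 := congrArg Complex.im h0
    simp at a0 a1
    simp [a0, a1] at hh
  have hnz : ‖(⟨ν 0, ν 1⟩ : ℂ)‖ = r := by
    rw [Complex.norm_eq_sqrt_sq_add_sq]
  refine ⟨!₂[Real.arsinh (-ν 2 / r), Complex.arg ⟨ν 0, ν 1⟩], ?_⟩
  refine space3_ext ?_ ?_ ?_
  · simp [normalParam, hC, Complex.cos_arg hz, hnz]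
    field_simp
  · simp [normalParam, hC, Complex.sin_arg, hnz]
    field_simp
  · simp [normalParam, hC]
    field_simp

/-- Position in terms of the normal and the first integral. -/
theorem eq_screwParam_of_horizontal_support {x : Space3} {s : Plane2} {h b : ℝ}
    (hV : inner ℝ (normalParam s) (screwField h x) = 0)
    (hβ : normalParam s 0 * x 0 + normalParam s 1 * x 1 = b) :
    x = screwParam h b (x 2 - h * s 1 - b * s 0) s := by
  have hc := (Real.cosh_pos (s 0)).ne'
  have hsc := Real.sin_sq_add_cos_sq (s 1)
  rw [inner_space3] at hV
  simp [normalParam] at hV hβ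
  field_simp at hV hβ
  -- After clearing denominators, the two hypotheses give the components of (x₀, x₁) in the frame
  -- rotated by the angle s₁; rotating back solves for x₀ and x₁. The height holds by the choice of
  -- the shift.
  refine space3_ext ?_ ?_ ?_ <;> simp [screwParam]
  · linear_combination Real.cos (s 1) * hβ + Real.sin (s 1) * hV - x 0 * hsc
  · linear_combination Real.sin (s 1) * hβ - Real.cos (s 1) * hV - x 1 * hsc

/-- A branch of the argument with a prescribed value. -/
theorem exp_arg_sub_arg {N P Q : ℂ} {θ : ℝ} (hP : P ≠ 0) (hN : N ≠ 0) (hQ : Q ≠ 0)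
    (hθ : Complex.exp (θ * Complex.I) = Q / ‖Q‖) :
    Complex.exp ((((N * (starRingEnd ℂ) P).arg - (Q * (starRingEnd ℂ) P).arg + θ : ℝ) : ℂ)
      * Complex.I) = N / ‖N‖ := by
  have key : ∀ z : ℂ, z ≠ 0 → Complex.exp (z.arg * Complex.I) = z / ‖z‖ := by
    intro z hz
    have hz' : (‖z‖ : ℂ) ≠ 0 := by simpa using hz
    rw [eq_div_iff hz', mul_comm]
    exact Complex.norm_mul_exp_arg_mul_I z
  have hcP : (starRingEnd ℂ) P ≠ 0 := by simpa using hP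
  have nN : (‖N‖ : ℂ) ≠ 0 := by simpa using hN
  have nP : (‖P‖ : ℂ) ≠ 0 := by simpa using hP
  have nQ : (‖Q‖ : ℂ) ≠ 0 := by simpa using hQ
  push_cast
  rw [add_mul, sub_mul, Complex.exp_add, Complex.exp_sub, hθ, key _ (mul_ne_zero hN hcP),
    key _ (mul_ne_zero hQ hcP)]
  simp only [norm_mul, RCLike.norm_conj]
  push_cast
  field_simp

/-- Smooth local coordinates inverting `normalParam`. -/
theorem exists_normalParam_lift {n : Plane2 → Space3} {B : Set Plane2}
    (hn : ContDiffOn ℝ ∞ n B) (hn1 : ∀ u ∈ B, ‖n u‖ = 1) {p : Space3}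
    (hp : ∀ u ∈ B, 0 < n u 0 * p 0 + n u 1 * p 1) {q s : Plane2} (hq : q ∈ B)
    (hs : n q = normalParam s) :
    ∃ σ φ : Plane2 → ℝ, ContDiffOn ℝ ∞ σ B ∧ ContDiffOn ℝ ∞ φ B ∧
      (∀ u ∈ B, n u = normalParam !₂[σ u, φ u]) ∧ σ q = s 0 ∧ φ q = s 1 := by
  have hni := contDiffOn_euclidean.1 hn
  let N : Plane2 → ℂ := fun u => ⟨n u 0, n u 1⟩
  let P : ℂ := ⟨p 0, p 1⟩
  -- The hypothesis on p keeps N times the conjugate of P in the right half-plane, where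
  -- `Complex.arg` is smooth.
  have hre : ∀ u ∈ B, 0 < (N u * (starRingEnd ℂ) P).re := by
    intro u hu
    simpa [N, P] using hp u hu
  have hN : ∀ u ∈ B, N u ≠ 0 := by
    intro u hu h0; have := hre u hu; simp [h0] at this
  have hP : P ≠ 0 := by
    intro h0; have := hre q hq; simp [h0] at this
  have hnN : ∀ u, ‖N u‖ = √(n u 0 ^ 2 + n u 1 ^ 2) := fun u => by
    rw [Complex.norm_eq_sqrt_sq_add_sq]
  have hpos : ∀ u ∈ B, 0 < ‖N u‖ := fun u hu => norm_pos_iff.2 (hN u hu)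
  have hsq : ∀ u, ‖N u‖ ^ 2 = n u 0 ^ 2 + n u 1 ^ 2 := fun u => by
    rw [hnN, Real.sq_sqrt (by positivity)]
  have hNd : ContDiffOn ℝ ∞ N B := by
    have : N = fun u => (n u 0 : ℂ) + (n u 1 : ℂ) * Complex.I := by
      funext u
      apply Complex.ext <;> simp [N]
    rw [this]
    exact (Complex.ofRealCLM.contDiff.comp_contDiffOn (hni 0)).add
      ((Complex.ofRealCLM.contDiff.comp_contDiffOn (hni 1)).mul contDiffOn_const)
  have hexp : Complex.exp ((s 1 : ℝ) * Complex.I) = N q / ‖N q‖ := by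
    have hc := Real.cosh_pos (s 0)
    have e0 : n q 0 = Real.cos (s 1) / Real.cosh (s 0) := by rw [hs]; rfl
    have e1 : n q 1 = Real.sin (s 1) / Real.cosh (s 0) := by rw [hs]; rfl
    have hr : ‖N q‖ = 1 / Real.cosh (s 0) := by
      rw [hnN, Real.sqrt_eq_iff_mul_self_eq (by positivity) (by positivity), e0, e1]
      field_simp
      linear_combination Real.sin_sq_add_cos_sq (s 1)
    have hr' : (‖N q‖ : ℂ) ≠ 0 := by simpa using hN q hq
    rw [eq_div_iff hr', hr]
    apply Complex.ext
    · rw [Complex.re_mul_ofReal, Complex.exp_ofReal_mul_I_re]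
      simp only [N]
      rw [e0]
      ring
    · rw [Complex.im_mul_ofReal, Complex.exp_ofReal_mul_I_im]
      simp only [N]
      rw [e1]
      ring
  let σ : Plane2 → ℝ := fun u => Real.arsinh (-n u 2 / ‖N u‖)
  -- Subtracting the value at q and adding s₁ selects the branch of the angle with φ q = s₁.
  let φ : Plane2 → ℝ := fun u =>
    (N u * (starRingEnd ℂ) P).arg - (N q * (starRingEnd ℂ) P).arg + s 1
  have hcosh : ∀ u ∈ B, Real.cosh (σ u) = 1 / ‖N u‖ := by
    intro u hu
    have h1 : n u 0 ^ 2 + n u 1 ^ 2 + n u 2 ^ 2 = 1 := by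
      rw [← norm_sq_space3, hn1 u hu, one_pow]
    have := hpos u hu
    simp only [σ]
    rw [Real.cosh_arsinh, Real.sqrt_eq_iff_mul_self_eq (by positivity) (by positivity)]
    field_simp
    linear_combination h1 + hsq u
  have hsinh : ∀ u, Real.sinh (σ u) = -n u 2 / ‖N u‖ := fun u => Real.sinh_arsinh _
  refine ⟨σ, φ, ?_, ?_, ?_, ?_, by simp [φ]⟩
  · exact ((hni 2).neg.div (hNd.norm ℝ hN) (fun u hu => (hpos u hu).ne')).arsinh
  · refine ContDiffOn.add (ContDiffOn.sub ?_ contDiffOn_const) contDiffOn_const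
    have h1 : ContDiffOn ℝ ∞ (fun u => N u * (starRingEnd ℂ) P) B := hNd.mul contDiffOn_const
    intro u hu
    have h2 := ((Complex.contDiffAt_log (n := ∞) (Or.inl (hre u hu))).restrict_scalars
      ℝ).comp_contDiffWithinAt u (h1 u hu)
    refine (Complex.imCLM.contDiff.contDiffAt.comp_contDiffWithinAt u h2).congr
      (fun t _ => ?_) ?_ <;> simp [Complex.log_im]
  · intro u hu
    have he := exp_arg_sub_arg hP (hN u hu) (hN q hq) hexp
    have hne : (‖N u‖ : ℂ) ≠ 0 := by simpa using hN u hu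
    have hp' := hpos u hu
    have hre' := congrArg Complex.re he
    have him' := congrArg Complex.im he
    rw [Complex.exp_ofReal_mul_I_re, Complex.div_ofReal_re] at hre'
    rw [Complex.exp_ofReal_mul_I_im, Complex.div_ofReal_im] at him'
    have c1 : Real.cos (φ u) = n u 0 / ‖N u‖ := hre'
    have c2 : Real.sin (φ u) = n u 1 / ‖N u‖ := him'
    refine space3_ext ?_ ?_ ?_
    · simp [normalParam, hcosh u hu, c1]; field_simp
    · simp [normalParam, hcosh u hu, c2]; field_simp
    · simp [normalParam, hcosh u hu, hsinh u]; field_simp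
  · apply Real.sinh_injective
    have hr : Real.cosh (σ q) = Real.cosh (s 0) := by
      rw [← Real.sqrt_sq (Real.cosh_pos (σ q)).le, ← Real.sqrt_sq (Real.cosh_pos (s 0)).le]
      have h1 := hcosh q hq
      have hc := Real.cosh_pos (s 0)
      have e0 : n q 0 = Real.cos (s 1) / Real.cosh (s 0) := by rw [hs]; rfl
      have e1 : n q 1 = Real.sin (s 1) / Real.cosh (s 0) := by rw [hs]; rfl
      have h2 : ‖N q‖ = 1 / Real.cosh (s 0) := by
        rw [hnN, Real.sqrt_eq_iff_mul_self_eq (by positivity) (by positivity), e0, e1]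
        field_simp
        linear_combination Real.sin_sq_add_cos_sq (s 1)
      rw [h1, h2, one_div_one_div]
    have e2 : n q 2 = -(Real.sinh (s 0) / Real.cosh (s 0)) := by rw [hs]; rfl
    have := hcosh q hq
    rw [hr] at this
    have hp' := hpos q hq
    have hc := (Real.cosh_pos (s 0)).ne'
    rw [hsinh, e2, neg_neg, div_div, this]
    field_simp

namespace IsMinimalPatch

variable {F n : Plane2 → Space3} {B : Set Plane2}

/-- A minimal patch tangent to a screw motion field, whose normal is nowhere vertical, is a
reparametrised piece of a surface in the associate family. -/
theorem exists_screwParam_lift (hp : IsMinimalPatch F n B) (hB : IsPreconnected B) {h b d : ℝ}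
    (hb : h ≠ 0 ∨ b ≠ 0) (htan : ∀ u ∈ B, ∃ v, fderiv ℝ F u v = screwField h (F u))
    {p : Space3} (hpos : ∀ u ∈ B, 0 < n u 0 * p 0 + n u 1 * p 1) {q s : Plane2} (hq : q ∈ B)
    (hs : n q = normalParam s) (hF : F q = screwParam h b d s) :
    ∃ f : Plane2 → Plane2, ContDiffOn ℝ ∞ f B ∧
      (∀ u ∈ B, Function.Injective (fderiv ℝ f u)) ∧
      ∀ u ∈ B, n u = normalParam (f u) ∧ F u = screwParam h b d (f u) := by
  obtain ⟨σ, φ, hσ, hφ, hl, hσq, hφq⟩ :=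
    exists_normalParam_lift hp.contDiffOn_normal hp.norm_eq_one hpos hq hs
  have hβ : ∀ u ∈ B, n u 0 * F u 0 + n u 1 * F u 1 = b := by
    intro u hu
    rw [hp.horizontal_support_eq hB htan hu hq, hs, hF, horizontal_support_screwParam]
  -- A zero of the field lies on the axis and forces h = 0, while the first integral there is 0, so
  -- b = 0 as well.
  have hV : ∀ u ∈ B, screwField h (F u) ≠ 0 := by
    intro u hu h0
    have e0 := congrArg (fun x : Space3 => x 0) h0
    have e1 := congrArg (fun x : Space3 => x 1) h0
    have e2 := congrArg (fun x : Space3 => x 2) h0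
    have := hβ u hu
    simp at e0 e1 e2
    rw [e0, e1] at this
    rcases hb with hb | hb
    · exact hb e2
    · exact hb (by linarith)
  have hfs : ContDiffOn ℝ ∞ (fun u => !₂[σ u, φ u] : Plane2 → Plane2) B := by
    rw [contDiffOn_euclidean]
    intro i
    fin_cases i
    · exact hσ
    · exact hφ
  have hdσ : ∀ u ∈ B, HasFDerivAt σ (fderiv ℝ σ u) u := fun u hu =>
    ((hσ.contDiffAt (hp.isOpen.mem_nhds hu)).differentiableAt (by simp)).hasFDerivAt
  have hdφ : ∀ u ∈ B, HasFDerivAt φ (fderiv ℝ φ u) u := fun u hu =>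
    ((hφ.contDiffAt (hp.isOpen.mem_nhds hu)).differentiableAt (by simp)).hasFDerivAt
  -- In the coordinates (σ, φ) the frame is v = ∂/∂φ and w = ∂/∂σ. This follows by comparing dn from
  -- the structure equations with the derivative of the parametrised normal.
  have hframe : ∀ u ∈ B, ∃ v w, fderiv ℝ F u v = screwField h (F u) ∧
      fderiv ℝ F u w = cross (n u) (screwField h (F u)) ∧ fderiv ℝ σ u v = 0 ∧
      fderiv ℝ σ u w = 1 ∧ fderiv ℝ φ u v = 1 ∧ fderiv ℝ φ u w = 0 ∧
      ∀ a, ∃ α β : ℝ, a = α • v + β • w := by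
    intro u hu
    obtain ⟨v, w, h1, h2, h3, h4, h5⟩ := hp.exists_screw_frame htan hu (hV u hu)
    have hC := (Real.cosh_pos (σ u)).ne'
    have e0 : ∀ t ∈ B, n t 0 * Real.cosh (σ t) = Real.cos (φ t) := fun t ht => by
      have := (Real.cosh_pos (σ t)).ne'
      rw [hl t ht]; simp [normalParam]; field_simp
    have e1 : ∀ t ∈ B, n t 1 * Real.cosh (σ t) = Real.sin (φ t) := fun t ht => by
      have := (Real.cosh_pos (σ t)).ne'
      rw [hl t ht]; simp [normalParam]; field_simp
    have e2 : ∀ t ∈ B, n t 2 * Real.cosh (σ t) = -Real.sinh (σ t) := fun t ht => by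
      have := (Real.cosh_pos (σ t)).ne'
      rw [hl t ht]; simp [normalParam]; field_simp
    have hN := hp.hasFDerivAt_normal hu
    have hev : ∀ {f g : Plane2 → ℝ}, (∀ t ∈ B, f t = g t) → f =ᶠ[nhds u] g := fun hfg => by
      filter_upwards [hp.isOpen.mem_nhds hu] with t ht using hfg t ht
    have d0 := ((hN.space3_coord 0).mul (hdσ u hu).cosh).unique
      ((hdφ u hu).cos.congr_of_eventuallyEq (hev e0))
    have d1 := ((hN.space3_coord 1).mul (hdσ u hu).cosh).unique
      ((hdφ u hu).sin.congr_of_eventuallyEq (hev e1))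
    have d2 := ((hN.space3_coord 2).mul (hdσ u hu).cosh).unique
      ((hdσ u hu).sinh.neg.congr_of_eventuallyEq (hev e2))
    have E0 := e0 u hu
    have E1 := e1 u hu
    have E2 := e2 u hu
    have hsc := Real.sin_sq_add_cos_sq (φ u)
    have hch := Real.cosh_sq (σ u)
    have dσ : ∀ a, fderiv ℝ σ u a = -Real.cosh (σ u) ^ 2 * fderiv ℝ n u a 2 := by
      intro a
      have D2 := DFunLike.congr_fun d2 a
      simp at D2
      linear_combination Real.cosh (σ u) * D2 - Real.sinh (σ u) * fderiv ℝ σ u a * E2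
        - fderiv ℝ σ u a * hch
    have dφ : ∀ a, fderiv ℝ φ u a = Real.cosh (σ u) *
        (Real.cos (φ u) * fderiv ℝ n u a 1 - Real.sin (φ u) * fderiv ℝ n u a 0) := by
      intro a
      have D0 := DFunLike.congr_fun d0 a
      have D1 := DFunLike.congr_fun d1 a
      simp at D0 D1
      have hz : Real.cos (φ u) * n u 1 - Real.sin (φ u) * n u 0 = 0 := by
        rw [← E0, ← E1]; ring
      linear_combination -Real.cos (φ u) * D1 + Real.sin (φ u) * D0
        + Real.sinh (σ u) * fderiv ℝ σ u a * hz - fderiv ℝ φ u a * hsc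
    refine ⟨v, w, h1, h2, ?_, ?_, ?_, ?_, h5⟩
    · rw [dσ, h3]; simp
    · rw [dσ, h4]
      simp
      linear_combination (n u 0 * Real.cosh (σ u) + Real.cos (φ u)) * E0
        + (n u 1 * Real.cosh (σ u) + Real.sin (φ u)) * E1 + hsc
    · rw [dφ, h3]
      simp
      linear_combination Real.cos (φ u) * E0 + Real.sin (φ u) * E1 + hsc
    · rw [dφ, h4]
      simp
      right
      rw [← E0, ← E1]; ring
  -- Along v the height grows at rate h. Along w it grows at the third component of n × V, which is
  -- n₀F₀ + n₁F₁ = b.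
  have hz : ∀ u ∈ B, F u 2 - h * φ u - b * σ u = d := by
    intro u hu
    have hd : ∀ t ∈ B, HasFDerivAt (fun t => F t 2 - h * φ t - b * σ t) (0 : Plane2 →L[ℝ] ℝ) t := by
      intro t ht
      obtain ⟨v, w, h1, h2, h3, h4, h5, h6, h7⟩ := hframe t ht
      have := (((hp.hasFDerivAt ht).space3_coord 2).sub ((hdφ t ht).const_mul h)).sub
        ((hdσ t ht).const_mul b)
      convert! this using 1
      ext1 a
      obtain ⟨α, β, rfl⟩ := h7 a
      have := hβ t ht
      simp [map_add, h1, h2, h3, h4, h5, h6]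
      right
      linear_combination this
    have := hp.isOpen.is_const_of_fderiv_eq_zero (f := fun t => F t 2 - h * φ t - b * σ t) hB
      (fun t ht => (hd t ht).differentiableAt.differentiableWithinAt)
      (fun t ht => (hd t ht).fderiv) hu hq
    simp only at this
    rw [this, hσq, hφq, hF]
    simp [screwParam]
    ring
  refine ⟨fun u => !₂[σ u, φ u], hfs, fun u hu => ?_, fun u hu => ⟨hl u hu, ?_⟩⟩
  · obtain ⟨v, w, h1, h2, h3, h4, h5, h6, h7⟩ := hframe u hu
    rw [injective_iff_map_eq_zero]
    intro a ha
    have hf := ((hfs.contDiffAt (hp.isOpen.mem_nhds hu)).differentiableAt (by simp)).hasFDerivAt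
    have a0 := DFunLike.congr_fun ((hf.plane2_coord 0).unique (hdσ u hu)) a
    have a1 := DFunLike.congr_fun ((hf.plane2_coord 1).unique (hdφ u hu)) a
    obtain ⟨α, β, rfl⟩ := h7 a
    rw [ContinuousLinearMap.comp_apply, ha] at a0 a1
    simp [h3, h4, h5, h6] at a0 a1
    simp [← a0, ← a1]
  · have hin : inner ℝ (normalParam !₂[σ u, φ u]) (screwField h (F u)) = 0 := by
      obtain ⟨v, hv⟩ := htan u hu
      rw [← hl u hu, ← hv]; exact hp.inner_fderiv u hu v
    have h1 := eq_screwParam_of_horizontal_support (b := b) hin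
      (by rw [← hl u hu]; exact hβ u hu)
    have h2 := hz u hu
    simp only [Matrix.cons_val_zero, Matrix.cons_val_one] at h1
    rwa [h2] at h1

end IsMinimalPatch

/-! ### From vanishing mean curvature to minimal patches -/

theorem plane2_eq_sum (a : Plane2) :
    a = a 0 • EuclideanSpace.single 0 1 + a 1 • EuclideanSpace.single 1 1 := by
  refine plane2_ext ?_ ?_ <;> simp

/-- If x × y = 0, Lagrange's identity makes the Gram determinant vanish. Then |y|²e₀ - ⟨x, y⟩e₁ lies
in the kernel of D, so y = 0, against injectivity. -/
theorem cross_fderiv_ne_zero {D : Plane2 →L[ℝ] Space3} (hD : Function.Injective D) :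
    cross (D (EuclideanSpace.single 0 1)) (D (EuclideanSpace.single 1 1)) ≠ 0 := by
  intro h0
  set x := D (EuclideanSpace.single 0 1) with hx
  set y := D (EuclideanSpace.single 1 1) with hy
  have h1 : ‖x‖ ^ 2 * inner ℝ y y - inner ℝ x y * inner ℝ x y = 0 := by
    rw [← inner_cross_cross, h0, inner_zero_left]
  have h2 : D (inner ℝ y y • EuclideanSpace.single 0 1
      - inner ℝ x y • EuclideanSpace.single 1 1) = 0 := by
    rw [map_sub, map_smul, map_smul, ← hx, ← hy, ← inner_self_eq_zero (𝕜 := ℝ)]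
    simp only [inner_sub_left, inner_sub_right, inner_smul_left, inner_smul_right,
      conj_trivial, real_inner_comm x y]
    rw [real_inner_self_eq_norm_sq x]
    linear_combination inner ℝ y y * h1
  have h3 := (injective_iff_map_eq_zero D).1 hD _ h2
  have h4 := congrArg (fun z : Plane2 => z 0) h3
  have h5 : y = 0 := by simpa using h4
  have h6 := (injective_iff_map_eq_zero D).1 hD _ h5
  simpa using congrArg (fun z : Plane2 => z 1) h6

theorem contDiffOn_cross {f g : Plane2 → Space3} {B : Set Plane2} (hf : ContDiffOn ℝ ∞ f B)
    (hg : ContDiffOn ℝ ∞ g B) : ContDiffOn ℝ ∞ (fun u => cross (f u) (g u)) B := by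
  rw [contDiffOn_euclidean] at hf hg ⊢
  intro i
  fin_cases i
  · exact ((hf 1).mul (hg 2)).sub ((hf 2).mul (hg 1))
  · exact ((hf 2).mul (hg 0)).sub ((hf 0).mul (hg 2))
  · exact ((hf 0).mul (hg 1)).sub ((hf 1).mul (hg 0))

theorem inner_fderiv_eq_zero_of_coord {D : Plane2 →L[ℝ] Space3} {ν : Space3}
    (h : ∀ i, inner ℝ ν (D (EuclideanSpace.single i 1)) = 0) (a : Plane2) :
    inner ℝ ν (D a) = 0 := by
  rw [plane2_eq_sum a, map_add, map_smul, map_smul, inner_add_right, inner_smul_right,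
    inner_smul_right, h, h, mul_zero, mul_zero, add_zero]

theorem coordSecond_eq {F : Plane2 → Space3} {u : Plane2} (hF : ContDiffAt ℝ ∞ F u)
    (i j : Fin 2) : coordSecond F u i j =
      fderiv ℝ (fderiv ℝ F) u (EuclideanSpace.single i 1) (EuclideanSpace.single j 1) := by
  have h1 : DifferentiableAt ℝ (fderiv ℝ F) u :=
    (hF.fderiv_right (m := ∞) (by simp)).differentiableAt (by simp)
  have h2 := h1.hasFDerivAt.clm_apply
    (hasFDerivAt_const (EuclideanSpace.single j 1 : Plane2) u)
  have h3 : fderiv ℝ (fun v => coordTangent F v j) u = _ := h2.fderiv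
  rw [coordSecond, h3]
  simp

/-- The trace of a bilinear form with respect to the induced metric, in a basis that is
orthogonal with vectors of equal length. -/
theorem sum_inv_inducedMetric_mul {F : Plane2 → Space3} {u : Plane2}
    (hinj : Function.Injective (fderiv ℝ F u)) {a b : Plane2}
    (hab : ‖fderiv ℝ F u a‖ = ‖fderiv ℝ F u b‖)
    (hort : inner ℝ (fderiv ℝ F u a) (fderiv ℝ F u b) = 0)
    (K : Plane2 →L[ℝ] Plane2 →L[ℝ] ℝ) :
    K a a + K b b = ‖fderiv ℝ F u a‖ ^ 2 * ∑ i, ∑ j, (inducedMetric F u)⁻¹ i j *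
      K (EuclideanSpace.single i 1) (EuclideanSpace.single j 1) := by
  by_cases ha : a = 0
  · have hb : b = 0 := by
      rw [ha, map_zero, norm_zero, eq_comm, norm_eq_zero] at hab
      exact (injective_iff_map_eq_zero _).1 hinj _ hab
    simp [ha, hb]
  have hs : ‖fderiv ℝ F u a‖ ^ 2 ≠ 0 := by
    have := fun h => ha ((injective_iff_map_eq_zero _).1 hinj a h)
    positivity
  set D := fderiv ℝ F u with hD
  set s := ‖D a‖ ^ 2 with hsdef
  let P : Matrix (Fin 2) (Fin 2) ℝ := !![a 0, b 0; a 1, b 1]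
  have hDa : ∀ c : Plane2, D c = c 0 • D (EuclideanSpace.single 0 1)
      + c 1 • D (EuclideanSpace.single 1 1) := fun c => by
    conv_lhs => rw [plane2_eq_sum c, map_add, map_smul, map_smul]
  have hexp : ∀ c e : Plane2, inner ℝ (D c) (D e) = ∑ i, ∑ j, c i * inducedMetric F u i j * e j := by
    intro c e
    rw [hDa c, hDa e]
    simp only [inner_add_left, inner_add_right, inner_smul_left, inner_smul_right, conj_trivial,
      Fin.sum_univ_two, inducedMetric, Matrix.of_apply, coordTangent, ← hD]
    ring
  have haa : inner ℝ (D a) (D a) = s := real_inner_self_eq_norm_sq _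
  have hbb : inner ℝ (D b) (D b) = s := by rw [real_inner_self_eq_norm_sq, ← hab]
  have hba : inner ℝ (D b) (D a) = 0 := by rw [real_inner_comm]; exact hort
  -- P has columns a and b, so PᵀγP = s·1 expresses orthogonality and equal length; inverting gives
  -- γ⁻¹ = s⁻¹PPᵀ.
  have h1 : (s⁻¹ • (P.transpose * inducedMetric F u)) * P = 1 := by
    rw [Matrix.smul_mul, inv_smul_eq_iff₀ hs]
    rw [hexp] at haa hbb hba hort
    simp only [Fin.sum_univ_two] at haa hbb hba hort
    ext i j
    fin_cases i <;> fin_cases j <;>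
      simp [P, Matrix.mul_apply, Fin.sum_univ_two]
    · linear_combination haa
    · linear_combination hort
    · linear_combination hba
    · linear_combination hbb
  have h2 : (inducedMetric F u)⁻¹ = s⁻¹ • (P * P.transpose) := by
    apply Matrix.inv_eq_left_inv
    have := mul_eq_one_comm.1 h1
    rw [Matrix.mul_smul, ← Matrix.mul_assoc] at this
    rwa [Matrix.smul_mul]
  have hK : ∀ c : Plane2, K c c = ∑ i, ∑ j, c i * c j *
      K (EuclideanSpace.single i 1) (EuclideanSpace.single j 1) := by
    intro c
    conv_lhs => rw [plane2_eq_sum c]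
    simp only [map_add, map_smul, add_apply, smul_apply, Fin.sum_univ_two, smul_eq_mul]
    ring
  have hP : ∀ i j, (P * P.transpose) i j = a i * a j + b i * b j := by
    intro i j
    rw [Matrix.mul_apply, Fin.sum_univ_two]
    fin_cases i <;> fin_cases j <;> simp [P]
  rw [h2, hK a, hK b]
  simp only [Fin.sum_univ_two, Matrix.smul_apply, hP, smul_eq_mul]
  field_simp
  ring

/-- An immersion with vanishing mean curvature admits a unit normal field with self-adjoint and
traceless shape operator. -/
theorem exists_isMinimalPatch {F : Plane2 → Space3} {B : Set Plane2} (hB : IsOpen B)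
    (hF : ContDiffOn ℝ ∞ F B) (hinj : ∀ u ∈ B, Function.Injective (fderiv ℝ F u))
    (hmin : ∀ u ∈ B, ∀ ν, IsUnitNormal F u ν → meanCurvature F u ν = 0) :
    ∃ n, IsMinimalPatch F n B := by
  let m : Plane2 → Space3 := fun u => cross (fderiv ℝ F u (EuclideanSpace.single 0 1))
    (fderiv ℝ F u (EuclideanSpace.single 1 1))
  let n : Plane2 → Space3 := fun u => ‖m u‖⁻¹ • m u
  have hF' : ContDiffOn ℝ ∞ (fderiv ℝ F) B := hF.fderiv_of_isOpen hB (by simp)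
  have hm0 : ∀ u ∈ B, m u ≠ 0 := fun u hu => cross_fderiv_ne_zero (hinj u hu)
  have hm : ContDiffOn ℝ ∞ m B :=
    contDiffOn_cross (hF'.clm_apply contDiffOn_const) (hF'.clm_apply contDiffOn_const)
  have hn : ContDiffOn ℝ ∞ n B :=
    ((hm.norm ℝ hm0).inv fun u hu => norm_ne_zero_iff.2 (hm0 u hu)).smul hm
  have hn1 : ∀ u ∈ B, ‖n u‖ = 1 := fun u hu => by
    simp only [n]
    rw [norm_smul, norm_inv, norm_norm, inv_mul_cancel₀ (norm_ne_zero_iff.2 (hm0 u hu))]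
  have hnD : ∀ u ∈ B, ∀ a, inner ℝ (n u) (fderiv ℝ F u a) = 0 := fun u _ => by
    apply inner_fderiv_eq_zero_of_coord
    intro i
    simp only [n, inner_smul_left]
    rw [real_inner_comm]
    fin_cases i
    · simp [m, inner_cross_left]
    · simp [m, inner_cross_right]
  -- This is Weingarten's equation, from differentiating ⟨n, dF b⟩ = 0. Symmetry then comes from the
  -- second derivative, and the vanishing trace from the mean curvature.
  have hII : ∀ u ∈ B, ∀ a b, inner ℝ (fderiv ℝ n u a) (fderiv ℝ F u b) =
      -inner ℝ (n u) (fderiv ℝ (fderiv ℝ F) u a b) := by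
    intro u hu a b
    have hnb := hB.mem_nhds hu
    have h1 := ((hn.contDiffAt hnb).differentiableAt (by simp)).hasFDerivAt
    have h2 := ((hF'.contDiffAt hnb).differentiableAt (by simp)).hasFDerivAt.clm_apply
      (hasFDerivAt_const b u)
    have h3 := h1.inner ℝ h2
    have h4 : (fun t => inner ℝ (n t) (fderiv ℝ F t b)) =ᶠ[nhds u] fun _ => (0 : ℝ) := by
      filter_upwards [hnb] with t ht using hnD t ht b
    have h5 := DFunLike.congr_fun
      (h3.unique ((hasFDerivAt_const (0 : ℝ) u).congr_of_eventuallyEq h4)) a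
    simp [fderivInnerCLM_apply] at h5
    linarith
  refine ⟨n, hB, hF, hn, hinj, hn1, hnD, fun u hu a b => ?_, fun u hu a b hab hort => ?_⟩
  · rw [hII u hu, hII u hu]
    have hs := (hF.contDiffAt (hB.mem_nhds hu)).isSymmSndFDerivAt
      (by rw [minSmoothness_of_isRCLikeNormedField]; exact WithTop.coe_le_coe.2 le_top)
    rw [hs.eq a b]
  · rw [hII u hu, hII u hu]
    have h1 := sum_inv_inducedMetric_mul (hinj u hu) hab hort
      ((innerSL ℝ (n u)).postcomp Plane2 ∘L fderiv ℝ (fderiv ℝ F) u)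
    have h2 := hmin u hu (n u) ⟨hn1 u hu, fun i => hnD u hu _⟩
    simp only [meanCurvature, extrinsicCurvature,
      coordSecond_eq (hF.contDiffAt (hB.mem_nhds hu))] at h2
    simp [ContinuousLinearMap.postcomp_apply] at h1
    simp at h2
    rw [h2, mul_zero] at h1
    linarith

/-! ### Local diffeomorphisms and charts -/

/-- By dimension an injective differential is invertible, so the inverse function theorem applies.
Restricting to U keeps the differential invertible on the whole source, which makes the inverse
smooth on the whole target. -/
theorem isLocalDiffeomorphAt_of_injective_fderiv {f : Plane2 → Plane2} {U : Set Plane2}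
    (hU : IsOpen U) (hf : ContDiffOn ℝ ∞ f U) (hinj : ∀ u ∈ U, Function.Injective (fderiv ℝ f u))
    {u : Plane2} (hu : u ∈ U) : IsLocalDiffeomorphAt (𝓡 2) (𝓡 2) ∞ f u := by
  have hequiv : ∀ t ∈ U, ∃ f' : Plane2 ≃L[ℝ] Plane2,
      HasFDerivAt f (f' : Plane2 →L[ℝ] Plane2) t := by
    intro t ht
    let f' : Plane2 ≃L[ℝ] Plane2 :=
      (LinearEquiv.ofInjectiveEndo (fderiv ℝ f t).toLinearMap (hinj t ht)).toContinuousLinearEquiv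
    refine ⟨f', ?_⟩
    have h1 : (f' : Plane2 →L[ℝ] Plane2) = fderiv ℝ f t := by ext1 a; rfl
    rw [h1]
    exact ((hf.contDiffAt (hU.mem_nhds ht)).differentiableAt (by simp)).hasFDerivAt
  obtain ⟨f', hf'⟩ := hequiv u hu
  have hfu := hf.contDiffAt (hU.mem_nhds hu)
  let φ := (hfu.toOpenPartialHomeomorph f hf' (by simp)).restrOpen U hU
  have hφ : ∀ t, φ t = f t := fun _ => rfl
  have hsrc : φ.source ⊆ U := fun t ht => ht.2
  have hmem : u ∈ φ.source :=
    ⟨hfu.mem_toOpenPartialHomeomorph_source hf' (by simp), hu⟩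
  refine ⟨{ φ.toPartialEquiv with
      open_source := φ.open_source
      open_target := φ.open_target
      contMDiffOn_toFun := ?_
      contMDiffOn_invFun := ?_ }, hmem, fun t _ => rfl⟩
  · exact (hf.mono hsrc).contMDiffOn
  · refine ContDiffOn.contMDiffOn fun y hy => ContDiffAt.contDiffWithinAt ?_
    have hy' := φ.map_target hy
    obtain ⟨g', hg'⟩ := hequiv _ (hsrc hy')
    exact φ.contDiffAt_symm hy hg' (hf.contDiffAt (hU.mem_nhds (hsrc hy')))

section Surfaces

variable {M : Type*} [TopologicalSpace M] [ChartedSpace Plane2 M]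

theorem isLocalDiffeomorphAt_chartAt [IsManifold (𝓡 2) ∞ M] {p q : M}
    (hq : q ∈ (chartAt Plane2 p).source) :
    IsLocalDiffeomorphAt (𝓡 2) (𝓡 2) ∞ (chartAt Plane2 p) q :=
  ⟨{ (chartAt Plane2 p).toPartialEquiv with
      open_source := (chartAt Plane2 p).open_source
      open_target := (chartAt Plane2 p).open_target
      contMDiffOn_toFun := contMDiffOn_chart
      contMDiffOn_invFun := contMDiffOn_chart_symm }, hq, fun _ _ => rfl⟩

/-- The expression of a map in a chart. -/
abbrev chartMap (X : M → Space3) (p : M) : Plane2 → Space3 := X ∘ (chartAt Plane2 p).symm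

theorem contDiffOn_chartMap [IsManifold (𝓡 2) ∞ M] {X : M → Space3}
    (hX : ContMDiff (𝓡 2) (𝓡 3) ∞ X) (p : M) :
    ContDiffOn ℝ ∞ (chartMap X p) (chartAt Plane2 p).target :=
  (hX.comp_contMDiffOn (contMDiffOn_chart_symm (I := 𝓡 2) (n := ∞))).contDiffOn

theorem mfderiv_eq_fderiv_chartMap_comp [IsManifold (𝓡 2) ∞ M] {X : M → Space3}
    (hX : ContMDiff (𝓡 2) (𝓡 3) ∞ X) {p q : M} (hq : q ∈ (chartAt Plane2 p).source)
    (a : TangentSpace (𝓡 2) q) :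
    mfderiv (𝓡 2) (𝓡 3) X q a = fderiv ℝ (chartMap X p) (chartAt Plane2 p q)
      (mfderiv (𝓡 2) (𝓡 2) (chartAt Plane2 p) q a) := by
  have : IsManifold (𝓡 2) 1 M := IsManifold.of_le (n := ∞) (by simp)
  have he := mdifferentiable_chart (I := 𝓡 2) p
  have htgt := (chartAt Plane2 p).map_source hq
  have hd : DifferentiableAt ℝ (chartMap X p) (chartAt Plane2 p q) :=
    ((contDiffOn_chartMap hX p).contDiffAt
      ((chartAt Plane2 p).open_target.mem_nhds htgt)).differentiableAt (by simp)
  have h1 : X =ᶠ[nhds q] chartMap X p ∘ chartAt Plane2 p := by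
    filter_upwards [(chartAt Plane2 p).open_source.mem_nhds hq] with r hr
    simp [chartMap, (chartAt Plane2 p).left_inv hr]
  rw [h1.mfderiv_eq, mfderiv_comp q hd.mdifferentiableAt (he.mdifferentiableAt hq),
    mfderiv_eq_fderiv]
  rfl

theorem exists_mfderiv_chartAt_eq [IsManifold (𝓡 2) ∞ M] {p q : M}
    (hq : q ∈ (chartAt Plane2 p).source) (b : Plane2) :
    ∃ a : TangentSpace (𝓡 2) q, mfderiv (𝓡 2) (𝓡 2) (chartAt Plane2 p) q a = b := by
  have : IsManifold (𝓡 2) 1 M := IsManifold.of_le (n := ∞) (by simp)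
  exact (mdifferentiable_chart (I := 𝓡 2) p).mfderiv_surjective hq b

/-- The vector `ν` is orthogonal to the image of the differential of `X` at `q`. -/
def IsNormalAt (X : M → Space3) (q : M) (ν : Space3) : Prop :=
  ∀ a : TangentSpace (𝓡 2) q, inner ℝ ν (mfderiv (𝓡 2) (𝓡 3) X q a : Space3) = 0

/-- The vector field `V` on three-space is tangent to `X`. -/
def IsTangentField (X : M → Space3) (V : Space3 → Space3) : Prop :=
  ∀ q, ∃ a : TangentSpace (𝓡 2) q, (mfderiv (𝓡 2) (𝓡 3) X q a : Space3) = V (X q)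

theorem isNormalAt_iff [IsManifold (𝓡 2) ∞ M] {X : M → Space3}
    (hX : ContMDiff (𝓡 2) (𝓡 3) ∞ X) {p q : M} (hq : q ∈ (chartAt Plane2 p).source)
    {ν : Space3} : IsNormalAt X q ν ↔
      ∀ a, inner ℝ ν (fderiv ℝ (chartMap X p) (chartAt Plane2 p q) a) = 0 := by
  constructor
  · intro h b
    obtain ⟨a, rfl⟩ := exists_mfderiv_chartAt_eq hq b
    rw [← mfderiv_eq_fderiv_chartMap_comp hX hq]
    exact h a
  · intro h a
    rw [mfderiv_eq_fderiv_chartMap_comp hX hq]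
    exact h _

theorem IsTangentField.chartMap [IsManifold (𝓡 2) ∞ M] {X : M → Space3} {V : Space3 → Space3}
    (hV : IsTangentField X V) (hX : ContMDiff (𝓡 2) (𝓡 3) ∞ X) (p : M) {u : Plane2}
    (hu : u ∈ (chartAt Plane2 p).target) :
    ∃ v, fderiv ℝ (chartMap X p) u v = V (chartMap X p u) := by
  have hq := (chartAt Plane2 p).map_target hu
  obtain ⟨a, ha⟩ := hV ((chartAt Plane2 p).symm u)
  refine ⟨mfderiv (𝓡 2) (𝓡 2) (chartAt Plane2 p) _ a, ?_⟩
  have := mfderiv_eq_fderiv_chartMap_comp hX hq a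
  rw [(chartAt Plane2 p).right_inv hu] at this
  exact this.symm.trans ha

theorem IsMinimalImmersion.injective_fderiv_chartMap [IsManifold (𝓡 2) ∞ M] {X : M → Space3}
    (hX : IsMinimalImmersion X) (p : M) {u : Plane2} (hu : u ∈ (chartAt Plane2 p).target) :
    Function.Injective (fderiv ℝ (chartMap X p) u) := by
  have hq := (chartAt Plane2 p).map_target hu
  rw [injective_iff_map_eq_zero]
  intro b hb
  obtain ⟨a, rfl⟩ := exists_mfderiv_chartAt_eq hq b
  have h1 := mfderiv_eq_fderiv_chartMap_comp hX.smooth hq a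
  rw [(chartAt Plane2 p).right_inv hu] at h1
  have h2 : a = 0 := (injective_iff_map_eq_zero _).1 (hX.immersion _) a (h1.trans hb)
  rw [h2, map_zero]
  rfl

theorem IsMinimalImmersion.exists_isMinimalPatch [IsManifold (𝓡 2) ∞ M] {X : M → Space3}
    (hX : IsMinimalImmersion X) (p : M) :
    ∃ n, IsMinimalPatch (chartMap X p) n (chartAt Plane2 p).target :=
  _root_.exists_isMinimalPatch (chartAt Plane2 p).open_target (contDiffOn_chartMap hX.smooth p)
    (fun _ hu => hX.injective_fderiv_chartMap p hu)
    (fun u hu ν hν => hX.minimal _ (chart_mem_atlas Plane2 p) u hu ν hν)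

/-- A property that is constant on suitable neighbourhoods holds everywhere on a connected space
once it holds somewhere. -/
theorem forall_of_locally_propagates {N : Type*} [TopologicalSpace N] [PreconnectedSpace N]
    {P : N → Prop} (h : ∀ p, ∃ U ∈ nhds p, ∀ q ∈ U, P q → ∀ r ∈ U, P r) {p₀ : N} (h0 : P p₀) :
    ∀ p, P p := by
  have hcl : IsClopen {p | P p} := by
    constructor
    · rw [← isOpen_compl_iff, isOpen_iff_mem_nhds]
      intro p hp
      obtain ⟨U, hU, hP⟩ := h p
      filter_upwards [hU] with q hq hPq
      exact hp (hP q hq hPq p (mem_of_mem_nhds hU))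
    · rw [isOpen_iff_mem_nhds]
      intro p hp
      obtain ⟨U, hU, hP⟩ := h p
      filter_upwards [hU] with q hq
      exact hP p (mem_of_mem_nhds hU) hp q hq
  have := hcl.eq_univ ⟨p₀, h0⟩
  intro p
  have hp : p ∈ {p | P p} := this ▸ Set.mem_univ p
  exact hp

/-- Local reparametrisation of an immersed surface by a map given in a chart. -/
theorem exists_reparam_of_chart [IsManifold (𝓡 2) ∞ M] {X : M → Space3} {Z : Plane2 → Space3}
    {p q : M} (hq : q ∈ (chartAt Plane2 p).source) {f : Plane2 → Plane2} {U : Set Plane2}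
    (hU : IsOpen U) (hf : ContDiffOn ℝ ∞ f U)
    (hinj : ∀ u ∈ U, Function.Injective (fderiv ℝ f u)) (hqU : chartAt Plane2 p q ∈ U)
    (hXZ : ∀ u ∈ U, chartMap X p u = Z (f u)) :
    ∃ ψ : M → Plane2, IsLocalDiffeomorphAt (𝓡 2) (𝓡 2) ∞ ψ q ∧
      ∀ᶠ r in nhds q, X r = Z (ψ r) := by
  refine ⟨f ∘ chartAt Plane2 p, (isLocalDiffeomorphAt_chartAt hq).comp _ _
    (isLocalDiffeomorphAt_of_injective_fderiv hU hf hinj hqU), ?_⟩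
  have hc := ((chartAt Plane2 p).continuousAt hq).preimage_mem_nhds (hU.mem_nhds hqU)
  filter_upwards [hc, (chartAt Plane2 p).open_source.mem_nhds hq] with r hr hrs
  rw [Function.comp_apply, ← hXZ _ hr, chartMap, Function.comp_apply,
    (chartAt Plane2 p).left_inv hrs]

/-! ### Classification of surfaces tangent to a field in normal form -/

/-- An immersed surface with constant normal is a piece of a plane. -/
theorem isPieceOf_planeParam [IsManifold (𝓡 2) ∞ M] {X : M → Space3}
    (hX : IsMinimalImmersion X) {ν : Space3} (hν : ‖ν‖ = 1) {d : ℝ}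
    (h : ∀ q, IsNormalAt X q ν ∧ inner ℝ ν (X q) = d) : IsPieceOf X planeParam := by
  obtain ⟨b, hb⟩ := Orthonormal.exists_orthonormalBasis_extension_of_card_eq (𝕜 := ℝ)
    (E := Space3) (ι := Fin 3) (by simp) (v := fun _ => ν) (s := {2}) (by
      rw [orthonormal_iff_ite]
      rintro ⟨i, hi⟩ ⟨j, hj⟩
      simp only [Set.mem_singleton_iff] at hi hj
      subst hi hj
      simp [Set.domRestrict, hν])
  have hb2 : b 2 = ν := hb 2 rfl
  have hr : ∀ x, b.repr x 2 = inner ℝ ν x := fun x => by rw [b.repr_apply_apply, hb2]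
  -- With ν as third basis vector the surface lies at height d; Φ lifts the standard plane to that
  -- height and changes basis.
  let Φ : Space3 ≃ᵢ Space3 :=
    (IsometryEquiv.addRight (!₂[0, 0, d] : Space3)).trans b.repr.symm.toIsometryEquiv
  refine ⟨Φ, fun p => ?_⟩
  have hp := mem_chart_source Plane2 p
  let e := chartAt Plane2 p
  let L : Fin 3 → Space3 →L[ℝ] ℝ := fun i =>
    (EuclideanSpace.proj i : Space3 →L[ℝ] ℝ) ∘L (b.repr.toContinuousLinearEquiv : Space3 →L[ℝ] Space3)
  have hL : ∀ i x, L i x = b.repr x i := fun _ _ => rfl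
  let f : Plane2 → Plane2 := fun u => !₂[L 0 (chartMap X p u), L 1 (chartMap X p u)]
  have hF := contDiffOn_chartMap hX.smooth p
  have hf : ContDiffOn ℝ ∞ f e.target := by
    rw [contDiffOn_euclidean]
    intro i
    fin_cases i
    · exact (L 0).contDiff.comp_contDiffOn hF
    · exact (L 1).contDiff.comp_contDiffOn hF
  refine exists_reparam_of_chart (Z := fun s => Φ (planeParam s)) hp e.open_target hf
    (fun u hu => ?_) (e.map_source hp) (fun u hu => ?_)
  · have hnb := e.open_target.mem_nhds hu
    have hFd := ((hF.contDiffAt hnb).differentiableAt (by simp)).hasFDerivAt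
    have hfd := ((hf.contDiffAt hnb).differentiableAt (by simp)).hasFDerivAt
    have h0 := (hfd.plane2_coord 0).unique ((L 0).hasFDerivAt.comp u hFd)
    have h1 := (hfd.plane2_coord 1).unique ((L 1).hasFDerivAt.comp u hFd)
    rw [injective_iff_map_eq_zero]
    intro a ha
    have a0 := DFunLike.congr_fun h0 a
    have a1 := DFunLike.congr_fun h1 a
    rw [ContinuousLinearMap.comp_apply, ha, ContinuousLinearMap.comp_apply, hL] at a0 a1
    have hq := e.map_target hu
    have hn := (isNormalAt_iff hX.smooth hq).1 (h _).1 a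
    rw [e.right_inv hu] at hn
    apply (injective_iff_map_eq_zero _).1 (hX.injective_fderiv_chartMap p hu)
    apply b.repr.injective
    rw [map_zero]
    refine space3_ext ?_ ?_ ?_
    · simpa using a0.symm
    · simpa using a1.symm
    · rw [hr, hn]; rfl
  · apply b.repr.injective
    have h1 : b.repr (Φ (planeParam (f u))) = planeParam (f u) + !₂[0, 0, d] :=
      b.repr.apply_symm_apply _
    change _ = b.repr (Φ (planeParam (f u)))
    rw [h1]
    refine space3_ext ?_ ?_ ?_
    · simp [planeParam, f, hL]
    · simp [planeParam, f, hL]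
    · rw [hr, chartMap, Function.comp_apply, (h _).2]; simp [planeParam]

/-- Restricting a chart to a ball gives small connected patches. -/
theorem exists_ball_patch {X : M → Space3} (p : M) {W : Set Plane2} (hW : W ∈ nhds (chartAt Plane2 p p)) {n : Plane2 → Space3}
    (hn : IsMinimalPatch (chartMap X p) n (chartAt Plane2 p).target) :
    ∃ B ⊆ W ∩ (chartAt Plane2 p).target, IsPreconnected B ∧ chartAt Plane2 p p ∈ B ∧
      IsMinimalPatch (chartMap X p) n B ∧
      (chartAt Plane2 p).source ∩ chartAt Plane2 p ⁻¹' B ∈ nhds p := by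
  have hp := mem_chart_source Plane2 p
  obtain ⟨ε, hε, hB⟩ := Metric.mem_nhds_iff.1
    (Filter.inter_mem hW ((chartAt Plane2 p).open_target.mem_nhds
      ((chartAt Plane2 p).map_source hp)))
  refine ⟨_, hB, (convex_ball _ _).isPreconnected, Metric.mem_ball_self hε,
    hn.mono Metric.isOpen_ball (hB.trans Set.inter_subset_right), ?_⟩
  exact Filter.inter_mem ((chartAt Plane2 p).open_source.mem_nhds hp)
    (((chartAt Plane2 p).continuousAt hp).preimage_mem_nhds (Metric.ball_mem_nhds _ hε))

/-- Two unit normals at a point agree up to sign. -/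
theorem IsMinimalPatch.eq_or_eq_neg {F n : Plane2 → Space3} {B : Set Plane2}
    (hp : IsMinimalPatch F n B) {u : Plane2} (hu : u ∈ B) {ν : Space3} (hν : ‖ν‖ = 1)
    (h : ∀ a, inner ℝ ν (fderiv ℝ F u a) = 0) : n u = ν ∨ n u = -ν := by
  have hn := hp.norm_eq_one u hu
  have h0 : inner ℝ (n u) (ν - inner ℝ (n u) ν • n u) = 0 := by
    rw [inner_sub_right, inner_smul_right, real_inner_self_eq_norm_sq, hn]; ring
  obtain ⟨a, ha⟩ := hp.exists_fderiv_eq hu h0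
  have h1 := h a
  rw [ha, inner_sub_right, inner_smul_right, real_inner_self_eq_norm_sq, hν,
    real_inner_comm (n u) ν] at h1
  have h2 : (inner ℝ (n u) ν - 1) * (inner ℝ (n u) ν + 1) = 0 := by
    linear_combination -h1
  rcases mul_eq_zero.1 h2 with h3 | h3
  · left
    rw [← sub_eq_zero, ← inner_self_eq_zero (𝕜 := ℝ), inner_sub_left, inner_sub_right,
      inner_sub_right, real_inner_self_eq_norm_sq, real_inner_self_eq_norm_sq, hn, hν,
      real_inner_comm (n u) ν]
    linarith
  · right
    rw [← sub_eq_zero, sub_neg_eq_add, ← inner_self_eq_zero (𝕜 := ℝ), inner_add_left,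
      inner_add_right, inner_add_right, real_inner_self_eq_norm_sq, real_inner_self_eq_norm_sq,
      hn, hν, real_inner_comm (n u) ν]
    linarith

/-- If locally the normal is constant whenever it equals `ν` at one point, then a connected
surface with normal `ν` at one point is planar. -/
theorem isPieceOf_planeParam_of_locally [IsManifold (𝓡 2) ∞ M] [ConnectedSpace M]
    {X : M → Space3} (hX : IsMinimalImmersion X) {ν : Space3} (hν : ‖ν‖ = 1)
    (hloc : ∀ (F n : Plane2 → Space3) (B : Set Plane2), IsMinimalPatch F n B →
      IsPreconnected B → (∃ p, F = chartMap X p ∧ B ⊆ (chartAt Plane2 p).target) →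
      ∀ u ∈ B, n u = ν → ∀ t ∈ B, n t = ν)
    {p₀ : M} (h0 : IsNormalAt X p₀ ν) : IsPieceOf X planeParam := by
  refine isPieceOf_planeParam hX hν (d := inner ℝ ν (X p₀)) ?_
  refine forall_of_locally_propagates (p₀ := p₀) (fun p => ?_) ⟨h0, rfl⟩
  obtain ⟨n, hn⟩ := hX.exists_isMinimalPatch p
  obtain ⟨B, hBW, hBc, hpB, hnB, hU⟩ := exists_ball_patch p Filter.univ_mem hn
  refine ⟨_, hU, fun q hq hPq r hr => ?_⟩
  have key : ∀ m, IsMinimalPatch (chartMap X p) m B → m (chartAt Plane2 p q) = ν →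
      IsNormalAt X r ν ∧ inner ℝ ν (X r) = inner ℝ ν (X p₀) := by
    intro m hm hmq
    have hmν := hloc _ _ _ hm hBc ⟨p, rfl, fun t ht => (hBW ht).2⟩ _ hq.2 hmq
    constructor
    · rw [isNormalAt_iff hX.smooth hr.1, ← hmν _ hr.2]
      exact hm.inner_fderiv _ hr.2
    · have := hm.inner_eq_of_normal_eq hBc hmν hr.2 hq.2
      simp only [chartMap, Function.comp_apply, (chartAt Plane2 p).left_inv hr.1,
        (chartAt Plane2 p).left_inv hq.1] at this
      rw [this, hPq.2]
  -- The normal chosen in the chart may be -ν at q, in which case its negative is used.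
  rcases hnB.eq_or_eq_neg hq.2 hν ((isNormalAt_iff hX.smooth hq.1).1 hPq.1) with h | h
  · exact key _ hnB h
  · exact key _ hnB.neg (by rw [h, neg_neg])

/-- A connected minimal surface tangent to a constant field is planar. -/
theorem isPieceOf_planeParam_of_translation [IsManifold (𝓡 2) ∞ M] [ConnectedSpace M]
    {X : M → Space3} (hX : IsMinimalImmersion X) {b : Space3} (hb : b ≠ 0)
    (hV : IsTangentField X fun _ => b) : IsPieceOf X planeParam := by
  obtain ⟨p₀⟩ := (inferInstance : Nonempty M)
  obtain ⟨n, hn⟩ := hX.exists_isMinimalPatch p₀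
  have hp := mem_chart_source Plane2 p₀
  have ht := (chartAt Plane2 p₀).map_source hp
  refine isPieceOf_planeParam_of_locally hX (hn.norm_eq_one _ ht) ?_
    ((isNormalAt_iff hX.smooth hp).2 (hn.inner_fderiv _ ht))
  rintro F m B hm hB ⟨p, rfl, hBp⟩ u hu hmu t ht
  rw [← hmu]
  exact hm.normal_eq_of_translation hB hb (fun r hr => hV.chartMap hX.smooth p (hBp hr)) ht hu

/-- A connected minimal surface tangent to a rotation field with horizontal tangent plane at some
point is planar. -/
theorem isPieceOf_planeParam_of_rotation [IsManifold (𝓡 2) ∞ M] [ConnectedSpace M]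
    {X : M → Space3} (hX : IsMinimalImmersion X) (hV : IsTangentField X (screwField 0))
    {p₀ : M} (h0 : IsNormalAt X p₀ !₂[0, 0, 1]) : IsPieceOf X planeParam := by
  have hν : ‖(!₂[0, 0, 1] : Space3)‖ = 1 := by
    rw [← sq_eq_sq₀ (norm_nonneg _) zero_le_one, norm_sq_space3]
    simp
  refine isPieceOf_planeParam_of_locally hX hν ?_ h0
  rintro F m B hm hB ⟨p, rfl, hBp⟩ u hu hmu t ht
  have htan : ∀ r ∈ B, _ := fun r hr => hV.chartMap hX.smooth p (hBp hr)
  rw [← hmu]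
  refine hm.normal_eq_of_horizontal_support_eq_zero hB htan (fun r hr => ?_) ht hu
  -- The first integral is zero where the normal is vertical, hence on all of B.
  rw [hm.horizontal_support_eq hB htan hr hu, hmu]
  simp

theorem norm_normalParam (s : Plane2) : ‖normalParam s‖ = 1 := by
  rw [← sq_eq_sq₀ (norm_nonneg _) zero_le_one, norm_sq_space3]
  have := (Real.cosh_pos (s 0)).ne'
  simp [normalParam]
  field_simp
  linear_combination Real.sin_sq_add_cos_sq (s 1) - Real.cosh_sq (s 0)

/-- At a point with vertical normal, a surface tangent to a screw motion field has vanishing first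
integral and pitch. -/
theorem IsMinimalPatch.pitch_eq_zero_of_vertical {F n : Plane2 → Space3} {B : Set Plane2}
    (hp : IsMinimalPatch F n B) {h : ℝ} {u : Plane2} (hu : u ∈ B)
    (htan : ∃ v, fderiv ℝ F u v = screwField h (F u)) (hn : n u 0 ^ 2 + n u 1 ^ 2 = 0) :
    h = 0 ∧ n u 0 * F u 0 + n u 1 * F u 1 = 0 := by
  obtain ⟨v, hv⟩ := htan
  have h1 := hp.inner_fderiv u hu v
  have h2 := hp.norm_eq_one u hu
  have n0 : n u 0 = 0 := by nlinarith [sq_nonneg (n u 0), sq_nonneg (n u 1)]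
  have n1 : n u 1 = 0 := by nlinarith [sq_nonneg (n u 0), sq_nonneg (n u 1)]
  rw [hv, inner_space3] at h1
  have h3 := norm_sq_space3 (n u)
  rw [h2, n0, n1] at h3
  simp [n0, n1] at h1
  refine ⟨h1.resolve_left fun h0 => ?_, by simp [n0, n1]⟩
  rw [h0] at h3; norm_num at h3

/-- Each point has a neighbourhood on which the parameters of the associate family surface are
constant. -/
theorem exists_nhds_screwParam [IsManifold (𝓡 2) ∞ M] {X : M → Space3}
    (hX : IsMinimalImmersion X) {h b d : ℝ} (hb : h ≠ 0 ∨ b ≠ 0)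
    (hV : IsTangentField X (screwField h)) (p : M) :
    ∃ U ∈ nhds p, ∀ q ∈ U,
      (∃ s, IsNormalAt X q (normalParam s) ∧ X q = screwParam h b d s) → ∀ r ∈ U,
      (∃ s, IsNormalAt X r (normalParam s) ∧ X r = screwParam h b d s) ∧
      ∃ ψ : M → Plane2, IsLocalDiffeomorphAt (𝓡 2) (𝓡 2) ∞ ψ r ∧
        ∀ᶠ t in nhds r, X t = screwParam h b d (ψ t) := by
  obtain ⟨n, hn⟩ := hX.exists_isMinimalPatch p
  set e := chartAt Plane2 p with he
  have hp := mem_chart_source Plane2 p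
  have htp : e p ∈ e.target := e.map_source hp
  have htan : ∀ t ∈ e.target, ∃ v, fderiv ℝ (chartMap X p) t v = screwField h (chartMap X p t) :=
    fun t ht => hV.chartMap hX.smooth p ht
  have hXe : ∀ q ∈ e.source, chartMap X p (e q) = X q := fun q hq => by
    simp only [chartMap, Function.comp_apply]; rw [e.left_inv hq]
  by_cases hN : n (e p) 0 ^ 2 + n (e p) 1 ^ 2 = 0
  · obtain ⟨B, hBW, hBc, hpB, hnB, hU⟩ := exists_ball_patch p Filter.univ_mem hn
    refine ⟨_, hU, ?_⟩
    rintro q hq ⟨s, hs1, hs2⟩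
    -- A vertical normal at p forces h = 0 and first integral 0 on B. At q that integral is b up to
    -- sign, so b = 0 too, against `hb`.
    exfalso
    have htanB : ∀ t ∈ B, _ := fun t ht => htan t (hBW ht).2
    obtain ⟨h1, h2⟩ := hn.pitch_eq_zero_of_vertical htp (htan _ htp) hN
    refine (hb.resolve_left (by simpa using h1)) ?_
    have h3 := hnB.horizontal_support_eq hBc htanB hq.2 hpB
    have h4 := horizontal_support_screwParam h b d s
    rw [← hs2] at h4
    rw [h2, hXe q hq.1] at h3
    rcases hnB.eq_or_eq_neg hq.2 (norm_normalParam s)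
      ((isNormalAt_iff hX.smooth hq.1).1 hs1) with h5 | h5
    · rw [← h4, ← h5]; exact h3
    · rw [h5] at h3
      simp at h3
      linarith
  · have hni : ∀ i : Fin 3, ContinuousAt (fun t => n t i) (e p) := fun i =>
      ((contDiffOn_euclidean.1 hn.contDiffOn_normal i).continuousOn.continuousAt
        (hn.isOpen.mem_nhds htp))
    -- On a small ball the horizontal part of the normal stays in one half-plane, which provides a
    -- branch of the angle.
    have hW : {t | 0 < n t 0 * n (e p) 0 + n t 1 * n (e p) 1} ∈ nhds (e p) := by
      refine (((hni 0).mul continuousAt_const).add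
        ((hni 1).mul continuousAt_const)).eventually_const_lt ?_
      change 0 < n (e p) 0 * n (e p) 0 + n (e p) 1 * n (e p) 1
      rw [← pow_two, ← pow_two]
      exact lt_of_le_of_ne (by positivity) (Ne.symm hN)
    obtain ⟨B, hBW, hBc, hpB, hnB, hU⟩ := exists_ball_patch p hW hn
    refine ⟨_, hU, ?_⟩
    rintro q hq ⟨s, hs1, hs2⟩ r hr
    have htanB : ∀ t ∈ B, _ := fun t ht => htan t (hBW ht).2
    have key : ∀ (m : Plane2 → Space3) (x : Space3), IsMinimalPatch (chartMap X p) m B →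
        (∀ t ∈ B, 0 < m t 0 * x 0 + m t 1 * x 1) → m (e q) = normalParam s →
        (∃ s, IsNormalAt X r (normalParam s) ∧ X r = screwParam h b d s) ∧
        ∃ ψ : M → Plane2, IsLocalDiffeomorphAt (𝓡 2) (𝓡 2) ∞ ψ r ∧
          ∀ᶠ t in nhds r, X t = screwParam h b d (ψ t) := by
      intro m x hm hx hmq
      obtain ⟨f, hf, hfi, hfB⟩ := hm.exists_screwParam_lift hBc hb htanB hx hq.2 hmq
        ((hXe q hq.1).trans hs2)
      refine ⟨⟨f (e r), ?_, ?_⟩, exists_reparam_of_chart hr.1 hm.isOpen hf hfi hr.2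
        fun t ht => (hfB t ht).2⟩
      · rw [isNormalAt_iff hX.smooth hr.1, ← (hfB _ hr.2).1]
        exact hm.inner_fderiv _ hr.2
      · rw [← (hfB _ hr.2).2]; exact (hXe r hr.1).symm
    have hpos : ∀ t ∈ B, 0 < n t 0 * n (e p) 0 + n t 1 * n (e p) 1 := fun t ht => (hBW ht).1
    rcases hnB.eq_or_eq_neg hq.2 (norm_normalParam s)
      ((isNormalAt_iff hX.smooth hq.1).1 hs1) with h5 | h5
    · exact key n (n (e p)) hnB hpos h5
    · exact key (fun t => -n t) (-n (e p)) hnB.neg (fun t ht => by simpa using hpos t ht)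
        (by rw [h5, neg_neg])

/-- A connected minimal surface tangent to a screw motion field is planar or belongs to the
associate family of the catenoid. -/
theorem isPieceOf_planeParam_or_screwParam [IsManifold (𝓡 2) ∞ M] [ConnectedSpace M]
    {X : M → Space3} (hX : IsMinimalImmersion X) {h : ℝ} (hV : IsTangentField X (screwField h)) :
    IsPieceOf X planeParam ∨ ∃ b d : ℝ, 0 ≤ b ∧ (h ≠ 0 ∨ b ≠ 0) ∧
      ∀ p, ∃ ψ : M → Plane2, IsLocalDiffeomorphAt (𝓡 2) (𝓡 2) ∞ ψ p ∧
        ∀ᶠ t in nhds p, X t = screwParam h b d (ψ t) := by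
  obtain ⟨p⟩ := (inferInstance : Nonempty M)
  set e := chartAt Plane2 p with he
  have hp : p ∈ e.source := mem_chart_source Plane2 p
  have htp : e p ∈ e.target := e.map_source hp
  have htan : ∀ t ∈ e.target, ∃ v, fderiv ℝ (chartMap X p) t v = screwField h (chartMap X p t) :=
    fun t ht => hV.chartMap hX.smooth p ht
  have hXe : chartMap X p (e p) = X p := by
    simp only [chartMap, Function.comp_apply]; rw [e.left_inv hp]
  -- Flipping the normal flips the first integral, so b ≥ 0 can be arranged.
  obtain ⟨n, hn, hβ⟩ : ∃ n, IsMinimalPatch (chartMap X p) n e.target ∧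
      0 ≤ n (e p) 0 * X p 0 + n (e p) 1 * X p 1 := by
    obtain ⟨n, hn⟩ := hX.exists_isMinimalPatch p
    rcases le_total 0 (n (e p) 0 * X p 0 + n (e p) 1 * X p 1) with h0 | h0
    · exact ⟨n, hn, h0⟩
    · refine ⟨fun t => -n t, hn.neg, ?_⟩
      simp only [PiLp.neg_apply]
      linarith
  set b := n (e p) 0 * X p 0 + n (e p) 1 * X p 1 with hbdef
  by_cases hb : h ≠ 0 ∨ b ≠ 0
  · right
    have hN : n (e p) 0 ^ 2 + n (e p) 1 ^ 2 ≠ 0 := by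
      intro h0
      obtain ⟨h1, h2⟩ := hn.pitch_eq_zero_of_vertical htp (htan _ htp) h0
      rw [hXe] at h2
      exact hb.elim (fun h => h h1) (fun h => h h2)
    obtain ⟨s, hs⟩ := exists_normalParam_eq (hn.norm_eq_one _ htp) hN
    have hin : inner ℝ (normalParam s) (screwField h (X p)) = 0 := by
      obtain ⟨v, hv⟩ := htan _ htp
      rw [hs, ← hXe, ← hv]; exact hn.inner_fderiv _ htp v
    have hXp := eq_screwParam_of_horizontal_support (b := b) hin (by rw [hs])
    refine ⟨b, X p 2 - h * s 1 - b * s 0, hβ, hb, ?_⟩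
    have hP : ∃ s', IsNormalAt X p (normalParam s') ∧
        X p = screwParam h b (X p 2 - h * s 1 - b * s 0) s' := by
      refine ⟨s, ?_, hXp⟩
      rw [isNormalAt_iff hX.smooth hp, hs]
      exact hn.inner_fderiv _ htp
    -- The vertical shift is read off at the base point and is a fixed constant from here on.
    generalize X p 2 - h * s 1 - b * s 0 = d at hP
    have hall := forall_of_locally_propagates
      (P := fun q => ∃ s', IsNormalAt X q (normalParam s') ∧ X q = screwParam h b d s')
      (fun q => by
        obtain ⟨U, hU, hprop⟩ := exists_nhds_screwParam (d := d) hX hb hV q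
        exact ⟨U, hU, fun q hq hPq r hr => (hprop q hq hPq r hr).1⟩) hP
    intro q
    obtain ⟨U, hU, hprop⟩ := exists_nhds_screwParam (d := d) hX hb hV q
    exact (hprop q (mem_of_mem_nhds hU) (hall q) q (mem_of_mem_nhds hU)).2
  · left
    rw [not_or, not_not, not_not] at hb
    obtain ⟨h0, hb0⟩ := hb
    subst h0
    obtain ⟨B, hBW, hBc, hpB, hnB, -⟩ := exists_ball_patch p Filter.univ_mem hn
    have htanB : ∀ t ∈ B, _ := fun t ht => htan t (hBW ht).2
    -- The base point may lie on the axis, where the first integral says nothing about the normal,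
    -- so a point off the axis is used.
    obtain ⟨t, htB, hVt⟩ : ∃ t ∈ B, screwField 0 (chartMap X p t) ≠ 0 := by
      by_contra! hcon
      refine hnB.not_eventually_screwField_eq_zero (h := 0) hpB ?_
      filter_upwards [hnB.isOpen.mem_nhds hpB] with t ht using hcon t ht
    have hβt : n t 0 * chartMap X p t 0 + n t 1 * chartMap X p t 1 = 0 := by
      rw [hnB.horizontal_support_eq hBc htanB htB hpB, hXe]; exact hb0
    obtain ⟨n0, n1⟩ := hnB.normal_vertical_of_horizontal_support_eq_zero htanB htB hβt hVt
    have ht := (hBW htB).2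
    refine isPieceOf_planeParam_of_rotation hX hV (p₀ := e.symm t) ?_
    rw [isNormalAt_iff hX.smooth (p := p) (e.map_target ht)]
    intro a
    have h1 := hnB.inner_fderiv t htB a
    have h2 := norm_sq_space3 (n t)
    rw [hnB.norm_eq_one t htB, n0, n1] at h2
    rw [inner_space3, n0, n1] at h1
    have h3 : n t 2 ≠ 0 := fun h3 => by rw [h3] at h2; norm_num at h2
    rw [← he, e.right_inv ht]
    simpa [inner_space3, h3] using h1

/-! ### Reparametrisation to the standard forms -/

/-- These are the changes from conformal parameters to (ρ, φ): k rescales the radial parameter and a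
shifts the angle. -/
theorem isLocalDiffeomorphAt_stretch {k : ℝ → ℝ} (hk : ContDiff ℝ ∞ k) (hk' : ∀ x, deriv k x ≠ 0)
    (a : ℝ) (s : Plane2) :
    IsLocalDiffeomorphAt (𝓡 2) (𝓡 2) ∞ (fun s : Plane2 => (!₂[k (s 0), s 1 - a] : Plane2)) s := by
  have hc : ∀ i : Fin 2, ContDiff ℝ ∞ fun s : Plane2 => s i := fun i =>
    (EuclideanSpace.proj i : Plane2 →L[ℝ] ℝ).contDiff
  have hf : ContDiff ℝ ∞ (fun s : Plane2 => (!₂[k (s 0), s 1 - a] : Plane2)) := by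
    rw [contDiff_euclidean]
    intro i
    fin_cases i
    · exact hk.comp (hc 0)
    · exact (hc 1).sub contDiff_const
  refine isLocalDiffeomorphAt_of_injective_fderiv isOpen_univ hf.contDiffOn (fun u _ => ?_)
    (Set.mem_univ s)
  have hfd := (hf.contDiffAt (x := u)).differentiableAt (by simp) |>.hasFDerivAt
  have hid := (hasFDerivAt_id (𝕜 := ℝ) u)
  have h0 := (hfd.plane2_coord 0).unique
    (((hk.differentiable (by simp)).differentiableAt.hasDerivAt (x := u 0)).comp_hasFDerivAt u
      (hid.plane2_coord 0))
  have h1 := (hfd.plane2_coord 1).unique ((hid.plane2_coord 1).sub_const a)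
  rw [injective_iff_map_eq_zero]
  intro v hv
  have a0 := DFunLike.congr_fun h0 v
  have a1 := DFunLike.congr_fun h1 v
  rw [ContinuousLinearMap.comp_apply, hv] at a0 a1
  simp at a0 a1
  exact plane2_ext (a0.resolve_left (hk' _)) a1.symm

theorem isPieceOf_of_reparam {X : M → Space3} {Z Y : Plane2 → Space3}
    (hX : ∀ p, ∃ ψ : M → Plane2, IsLocalDiffeomorphAt (𝓡 2) (𝓡 2) ∞ ψ p ∧
        ∀ᶠ t in nhds p, X t = Z (ψ t)) {θ : Plane2 → Plane2}
    (hθ : ∀ s, IsLocalDiffeomorphAt (𝓡 2) (𝓡 2) ∞ θ s) {c : Space3}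
    (hZ : ∀ s, Z s = Y (θ s) + c) : IsPieceOf X Y := by
  refine ⟨IsometryEquiv.addRight c, fun p => ?_⟩
  obtain ⟨ψ, hψ, hXψ⟩ := hX p
  refine ⟨θ ∘ ψ, hψ.comp _ _ (hθ _), ?_⟩
  filter_upwards [hXψ] with t ht
  rw [ht, hZ]; rfl

theorem isPieceOf_of_screwParam {X : M → Space3} {h b d : ℝ} (hh : 0 ≤ h) (hb : 0 ≤ b)
    (hhb : h ≠ 0 ∨ b ≠ 0)
    (hX : ∀ p, ∃ ψ : M → Plane2, IsLocalDiffeomorphAt (𝓡 2) (𝓡 2) ∞ ψ p ∧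
        ∀ᶠ t in nhds p, X t = screwParam h b d (ψ t)) :
    (∃ κ : ℝ, 0 < κ ∧ IsPieceOf X (helicoidParam κ)) ∨
    (∃ c : ℝ, 0 < c ∧ IsPieceOf X (catenoidParam c)) ∨
    (∃ c l : ℝ, 0 < c ∧ 0 < l ∧ l < 1 ∧ IsPieceOf X (scherkParam c l)) := by
  rcases hh.eq_or_lt with rfl | hh
  · have hb' : 0 < b := lt_of_le_of_ne hb (Ne.symm (by simpa using hhb))
    refine Or.inr (Or.inl ⟨b, hb', ?_⟩)
    refine isPieceOf_of_reparam hX (c := !₂[0, 0, d]) (isLocalDiffeomorphAt_stretch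
      (k := fun x => b * x) (contDiff_const.mul contDiff_id) (fun x => ?_) 0) (fun s => ?_)
    · rw [deriv_const_mul_field]; simpa using hb'.ne'
    · refine space3_ext ?_ ?_ ?_ <;>
        simp [screwParam, catenoidParam, mul_div_cancel_left₀ _ hb'.ne']
  rcases hb.eq_or_lt with rfl | hb
  · refine Or.inl ⟨h, hh, ?_⟩
    -- Here ρ = h sinh s₀. The vector (sin s₁, -cos s₁) is the unit vector at angle s₁ - π/2, and
    -- the translation makes up for the height lost in this shift.
    refine isPieceOf_of_reparam hX (c := !₂[0, 0, d + h * (Real.pi / 2)])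
      (isLocalDiffeomorphAt_stretch (k := fun x => h * Real.sinh x)
        (contDiff_const.mul Real.contDiff_sinh) (fun x => ?_) (Real.pi / 2)) (fun s => ?_)
    · rw [deriv_const_mul_field, Real.deriv_sinh]
      exact mul_ne_zero hh.ne' (Real.cosh_pos x).ne'
    · refine space3_ext ?_ ?_ ?_ <;>
        simp [screwParam, helicoidParam, Real.cos_sub_pi_div_two, Real.sin_sub_pi_div_two]
      ring
  -- Normalising (h, b) to unit length gives l = h / c and √(1 - l²) = b / c.
  · set c := √(h ^ 2 + b ^ 2) with hc
    have hc0 : 0 < c := Real.sqrt_pos.2 (by positivity)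
    have hc2 : c ^ 2 = h ^ 2 + b ^ 2 := Real.sq_sqrt (by positivity)
    have hl : √(1 - (h / c) ^ 2) = b / c := by
      rw [Real.sqrt_eq_iff_mul_self_eq_of_pos (by positivity)]
      field_simp
      linarith
    refine Or.inr (Or.inr ⟨c, h / c, hc0, by positivity, ?_, ?_⟩)
    · rw [div_lt_one hc0]
      nlinarith
    refine isPieceOf_of_reparam hX (c := !₂[0, 0, d]) (isLocalDiffeomorphAt_stretch
      (k := fun x => c * x) (contDiff_const.mul contDiff_id) (fun x => ?_) 0) (fun s => ?_)
    · rw [deriv_const_mul_field]; simpa using hc0.ne'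
    · have hs : c * s 0 / c = s 0 := mul_div_cancel_left₀ _ hc0.ne'
      refine space3_ext ?_ ?_ ?_ <;> simp [screwParam, scherkParam, hl, hs] <;> field_simp <;> ring

/-! ### Killing fields of one-parameter groups of isometries -/

/-- A vector field with skew differences is affine with skew linear part. -/
theorem exists_skew_linear {V : Space3 → Space3}
    (hV : ∀ x y, inner ℝ (V x - V y) (x - y) = 0) :
    ∃ A : Space3 →L[ℝ] Space3, (∀ x y, inner ℝ (A x) y = -inner ℝ x (A y)) ∧
      ∀ x, V x = A x + V 0 := by
  have hdiag : ∀ x, inner ℝ (V x - V 0) x = 0 := fun x => by simpa using hV x 0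
  -- This is polarisation. A map that has an adjoint, here minus itself, is automatically linear.
  have hskew : ∀ x y, inner ℝ (V x - V 0) y = -inner ℝ x (V y - V 0) := by
    intro x y
    have h1 := hV x y
    have h2 := hdiag x
    have h3 := hdiag y
    rw [real_inner_comm]
    simp only [inner_sub_left, inner_sub_right, real_inner_comm] at h1 h2 h3 ⊢
    linarith
  have hext : ∀ {u v : Space3}, (∀ z, inner ℝ u z = inner ℝ v z) → u = v := fun h =>
    ext_inner_right ℝ h
  refine ⟨LinearMap.toContinuousLinearMap
    { toFun := fun x => V x - V 0
      map_add' := fun x y => hext fun z => ?_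
      map_smul' := fun c x => hext fun z => ?_ }, hskew, fun x => ?_⟩
  · rw [inner_add_left, hskew, hskew, hskew, inner_add_left]; ring
  · rw [RingHom.id_apply, inner_smul_left, hskew, hskew, inner_smul_left]; simp
  · change V x = V x - V 0 + V 0
    rw [sub_add_cancel]

/-- Differentiating |g_t x - g_t y|² = |x - y|² at 0 gives a field with skew differences. If it
vanished identically, the group law would make every orbit stationary, against nontriviality. -/
theorem IsOneParameterIsometryGroup.exists_killing_field {g : ℝ → Space3 → Space3}
    (hg : IsOneParameterIsometryGroup g) (hnt : ∃ t x, g t x ≠ x) :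
    ∃ (A : Space3 →L[ℝ] Space3) (b : Space3), (∀ x y, inner ℝ (A x) y = -inner ℝ x (A y)) ∧
      (∃ x, A x + b ≠ 0) ∧ ∀ x, HasDerivAt (fun t => g t x) (A x + b) 0 := by
  let V : Space3 → Space3 := fun x => deriv (fun t => g t x) 0
  have hd : ∀ x, HasDerivAt (fun t => g t x) (V x) 0 := fun x =>
    ((hg.smooth x).differentiable (by simp) 0).hasDerivAt
  have hV : ∀ x y, inner ℝ (V x - V y) (x - y) = 0 := by
    intro x y
    have h1 := ((hd x).sub (hd y)).inner ℝ ((hd x).sub (hd y))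
    have h2 : (fun t => inner ℝ (((fun t => g t x) - fun t => g t y) t)
        (((fun t => g t x) - fun t => g t y) t)) = fun _ => ‖x - y‖ ^ 2 := by
      funext t
      rw [real_inner_self_eq_norm_sq, Pi.sub_apply, ← dist_eq_norm, (hg.isometry t).dist_eq,
        dist_eq_norm]
    rw [h2] at h1
    have h3 := h1.unique (hasDerivAt_const _ _)
    simp only [Pi.sub_apply, hg.zero] at h3
    rw [real_inner_comm] at h3
    linarith
  obtain ⟨A, hA, hAV⟩ := exists_skew_linear hV
  refine ⟨A, V 0, hA, ?_, fun x => hAV x ▸ hd x⟩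
  by_contra! hcon
  obtain ⟨t, x, hne⟩ := hnt
  apply hne
  have h0 : ∀ s, HasDerivAt (fun t => g t x) 0 s := by
    intro s
    have h1 := hd (g s x)
    rw [hAV, hcon] at h1
    have h2 : HasDerivAt (fun r => r - s) 1 s := (hasDerivAt_id s).sub_const s
    have h3 := HasDerivAt.scomp (h := fun r : ℝ => r - s) (g₁ := fun t => g t (g s x)) s
      (by rw [sub_self]; exact h1) h2
    rw [smul_zero] at h3
    convert! h3 using 1
    funext r
    simp only [Function.comp_apply]
    rw [← hg.add, sub_add_cancel]
  have := is_const_of_deriv_eq_zero (fun s => (h0 s).differentiableAt)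
    (fun s => (h0 s).deriv) t 0
  rw [this, hg.zero]

/-- A differentiable curve in the image of an immersion that is traced by a continuous curve in
the parameter space has tangent velocity. -/
theorem exists_fderiv_eq_of_curve {F : Plane2 → Space3} {c : ℝ → Plane2}
    (hF : ContDiffAt ℝ ∞ F (c 0)) (hinj : Function.Injective (fderiv ℝ F (c 0)))
    (hc : ContinuousAt c 0) {γ : ℝ → Space3} {v : Space3} (hγ : HasDerivAt γ v 0)
    (hFc : ∀ᶠ t in nhds 0, F (c t) = γ t) : ∃ a, fderiv ℝ F (c 0) a = v := by
  -- Composing F with a left inverse of its differential gives a local diffeomorphism of the plane.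
  -- Continuity of c then suffices to write it as a local inverse applied to P γ, which is
  -- differentiable at 0.
  obtain ⟨P, hP⟩ := LinearMap.exists_leftInverse_of_injective
    (fderiv ℝ F (c 0)).toLinearMap (LinearMap.ker_eq_bot.2 hinj)
  let P' : Space3 →L[ℝ] Plane2 := LinearMap.toContinuousLinearMap P
  have hPF : P' ∘L fderiv ℝ F (c 0) = (ContinuousLinearEquiv.refl ℝ Plane2 : Plane2 →L[ℝ] Plane2) := by
    ext1 a
    exact DFunLike.congr_fun hP a
  have hFs := hF.hasStrictFDerivAt (n := ∞) (by simp)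
  have hs : HasStrictFDerivAt (P' ∘ F)
      ((ContinuousLinearEquiv.refl ℝ Plane2 : Plane2 →L[ℝ] Plane2)) (c 0) := by
    rw [← hPF]
    exact P'.hasStrictFDerivAt.comp (c 0) hFs
  have hli := hs.eventually_left_inverse
  have hloc := hs.to_localInverse.hasFDerivAt
  have hγ0 : F (c 0) = γ 0 := hFc.self_of_nhds
  have hcd : HasDerivAt c (P' v) 0 := by
    have h1 : HasDerivAt (fun t => P' (γ t)) (P' v) 0 :=
      P'.hasFDerivAt.comp_hasDerivAt 0 hγ
    have h2 := HasFDerivAt.comp_hasDerivAt (f := fun t => P' (γ t)) 0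
      (by rw [← hγ0]; exact hloc) h1
    have h3 := h2.congr_of_eventuallyEq (f₁ := c) (by
      filter_upwards [hc.eventually hli, hFc] with t ht1 ht2
      rw [Function.comp_apply, ← ht2]
      exact ht1.symm)
    exact h3
  refine ⟨P' v, ?_⟩
  have h4 := (hF.differentiableAt (by simp)).hasFDerivAt.comp_hasDerivAt 0 hcd
  exact h4.unique (hγ.congr_of_eventuallyEq hFc)

theorem IsMinimalImmersion.isTangentField {M : Type*} [TopologicalSpace M]
    [ChartedSpace Plane2 M] [IsManifold (𝓡 2) ∞ M] {X : M → Space3} (hX : IsMinimalImmersion X)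
    {g : ℝ → Space3 → Space3} (hinv : IsInvariantUnder X g) {V : Space3 → Space3}
    (hV : ∀ x, HasDerivAt (fun t => g t x) (V x) 0) : IsTangentField X V := by
  intro p
  obtain ⟨ε, hε, c, hc, hc0, hcX⟩ := hinv p
  have hp := mem_chart_source Plane2 p
  set e := chartAt Plane2 p with he
  have hI : Set.Ioo (-ε) ε ∈ nhds (0 : ℝ) := Ioo_mem_nhds (by linarith) hε
  have hcc : ContinuousAt c 0 := hc.continuousAt hI
  have hec : ContinuousAt (e ∘ c) 0 :=
    ContinuousAt.comp (by rw [hc0]; exact e.continuousAt hp) hcc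
  have hec0 : (e ∘ c) 0 = e p := by simp [hc0]
  have ht := e.map_source hp
  obtain ⟨b, hb⟩ := exists_fderiv_eq_of_curve (F := chartMap X p) (c := e ∘ c)
    (by rw [hec0]; exact (contDiffOn_chartMap hX.smooth p).contDiffAt (e.open_target.mem_nhds ht))
    (by rw [hec0]; exact hX.injective_fderiv_chartMap p ht) hec (hV (X p)) (by
      filter_upwards [hI, hcc.preimage_mem_nhds (by rw [hc0]; exact e.open_source.mem_nhds hp)]
        with t ht1 ht2
      rw [← hcX t ht1]
      simp only [chartMap, Function.comp_apply]
      rw [e.left_inv ht2])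
  obtain ⟨a, ha⟩ := exists_mfderiv_chartAt_eq hp b
  refine ⟨a, ?_⟩
  rw [mfderiv_eq_fderiv_chartMap_comp hX.smooth hp, ha, ← hb, hec0]

/-! ### Normal form of Killing fields -/

/-- A skew 3 × 3 matrix has three free entries p, q, r, and its axial vector (r, -q, p) spans the
rotation axis. -/
theorem exists_unit_ker_of_skew {A : Space3 →L[ℝ] Space3}
    (hA : ∀ x y, inner ℝ (A x) y = -inner ℝ x (A y)) (hA0 : A ≠ 0) :
    ∃ ν, ‖ν‖ = 1 ∧ A ν = 0 := by
  set p := A (EuclideanSpace.single 0 1) 1 with hp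
  set q := A (EuclideanSpace.single 0 1) 2 with hq
  set r := A (EuclideanSpace.single 1 1) 2 with hr
  have hcoord : ∀ x i, A x i = -inner ℝ x (A (EuclideanSpace.single i 1)) := fun x i => by
    rw [← hA, EuclideanSpace.inner_single_right]; simp
  have hij : ∀ i j : Fin 3, A (EuclideanSpace.single i 1) j = -A (EuclideanSpace.single j 1) i :=
    fun i j => by rw [hcoord, EuclideanSpace.inner_single_left]; simp
  have h00 := hij 0 0
  have h11 := hij 1 1
  have h22 := hij 2 2
  have hAx : ∀ x, A x = !₂[-(p * x 1) - q * x 2, p * x 0 - r * x 2, q * x 0 + r * x 1] := by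
    intro x
    refine space3_ext ?_ ?_ ?_ <;> rw [hcoord, inner_space3]
    · simp; linear_combination -x 0 * (1 / 2) * h00
    · rw [hij 1 0]; simp; linear_combination -x 1 * (1 / 2) * h11
    · rw [hij 2 0, hij 2 1]; simp; linear_combination -x 2 * (1 / 2) * h22
  let z : Space3 := !₂[r, -q, p]
  have hz : A z = 0 := by
    rw [hAx]
    refine space3_ext ?_ ?_ ?_ <;> simp [z] <;> ring
  have hker0 : z ≠ 0 := by
    intro h0
    have e0 := congrArg (fun x : Space3 => x 0) h0
    have e1 := congrArg (fun x : Space3 => x 1) h0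
    have e2 := congrArg (fun x : Space3 => x 2) h0
    simp [z] at e0 e1 e2
    apply hA0
    ext1 x
    rw [hAx]
    refine space3_ext ?_ ?_ ?_ <;> simp [e0, e1, e2]
  refine ⟨‖z‖⁻¹ • z, ?_, by rw [map_smul, hz, smul_zero]⟩
  rw [norm_smul, norm_inv, norm_norm, inv_mul_cancel₀ (norm_ne_zero_iff.2 hker0)]

/-- A Killing field that is not constant is a screw motion field of non-negative pitch, up to
an isometry and a scale. -/
theorem exists_screw_normal_form {A : Space3 →L[ℝ] Space3} (b : Space3)
    (hA : ∀ x y, inner ℝ (A x) y = -inner ℝ x (A y)) (hA0 : A ≠ 0) :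
    ∃ (L : Space3 ≃ₗᵢ[ℝ] Space3) (c : Space3) (a h : ℝ), a ≠ 0 ∧ 0 ≤ h ∧
      ∀ x, L (A x + b) = a • screwField h (L x + c) := by
  obtain ⟨ν, hν, hAν⟩ := exists_unit_ker_of_skew hA hA0
  obtain ⟨e', he'⟩ := Orthonormal.exists_orthonormalBasis_extension_of_card_eq (𝕜 := ℝ)
    (E := Space3) (ι := Fin 3) (by simp) (v := fun _ => ν) (s := {2}) (by
      rw [orthonormal_iff_ite]
      rintro ⟨i, hi⟩ ⟨j, hj⟩
      simp only [Set.mem_singleton_iff] at hi hj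
      subst hi hj
      simp [Set.domRestrict, hν])
  obtain ⟨e, he2, hsign⟩ : ∃ e : OrthonormalBasis (Fin 3) ℝ Space3, A (e 2) = 0 ∧
      0 ≤ inner ℝ (e 2) b / inner ℝ (A (e 0)) (e 1) := by
    have h2 : e' 2 = ν := he' 2 rfl
    rcases le_total 0 (inner ℝ (e' 2) b / inner ℝ (A (e' 0)) (e' 1)) with h0 | h0
    · exact ⟨e', by rw [h2, hAν], h0⟩
    -- Swapping the two horizontal basis vectors reverses orientation and changes the sign of the
    -- pitch; both handednesses thus reduce to h ≥ 0.
    · refine ⟨e'.reindex (Equiv.swap 0 1), ?_, ?_⟩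
      · simp only [OrthonormalBasis.reindex_apply, Equiv.symm_swap]
        rw [Equiv.swap_apply_of_ne_of_ne (by decide) (by decide), h2, hAν]
      · simp only [OrthonormalBasis.reindex_apply, Equiv.symm_swap, Equiv.swap_apply_left,
          Equiv.swap_apply_right]
        rw [Equiv.swap_apply_of_ne_of_ne (by decide) (by decide), hA,
          real_inner_comm (A (e' 0)) (e' 1), div_neg]
        linarith
  set a := inner ℝ (A (e 0)) (e 1) with ha
  have hdiag : ∀ x, inner ℝ (A x) x = 0 := fun x => by
    have := hA x x; rw [real_inner_comm (A x)] at this; linarith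
  have hsum : ∀ z : Space3, z = inner ℝ (e 0) z • e 0 + inner ℝ (e 1) z • e 1
      + inner ℝ (e 2) z • e 2 := fun z => by
    conv_lhs => rw [← e.sum_repr' z, Fin.sum_univ_three]
  have hA0' : A (e 0) = a • e 1 := by
    rw [hsum (A (e 0)), real_inner_comm (A (e 0)) (e 0), hdiag, real_inner_comm (A (e 0)) (e 1),
      real_inner_comm (A (e 0)) (e 2), hA _ (e 2), he2, ← ha]
    simp
  have hA1' : A (e 1) = -a • e 0 := by
    rw [hsum (A (e 1)), real_inner_comm (A (e 1)) (e 1), hdiag, real_inner_comm (A (e 1)) (e 2),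
      hA _ (e 2), he2, real_inner_comm (A (e 1)) (e 0), hA (e 1) (e 0),
      real_inner_comm (A (e 0)) (e 1), ← ha]
    simp
  have ha0 : a ≠ 0 := by
    intro h0
    apply hA0
    ext1 x
    rw [hsum x]
    simp [map_add, hA0', hA1', he2, h0]
  have hr : ∀ x i, e.repr x i = inner ℝ (e i) x := fun x i => e.repr_apply_apply x i
  have hAi : ∀ x i, inner ℝ (e i) (A x) = -inner ℝ (A (e i)) x := fun x i => by
    rw [hA, neg_neg]
  -- The translation moves the axis of the motion to the third coordinate axis by absorbing the part
  -- of b orthogonal to e₂; the part along e₂ is a times the pitch.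
  refine ⟨e.repr, !₂[inner ℝ (e 1) b / a, -(inner ℝ (e 0) b / a), 0], a, inner ℝ (e 2) b / a,
    ha0, hsign, fun x => ?_⟩
  refine space3_ext ?_ ?_ ?_ <;> rw [hr, inner_add_right, hAi, PiLp.smul_apply]
  · rw [hA0', inner_smul_left, screwField_zero, PiLp.add_apply, hr]
    simp
    field_simp
    ring
  · rw [hA1', inner_smul_left, screwField_one, PiLp.add_apply, hr]
    simp
    field_simp
  · rw [he2, inner_zero_left, screwField_two]
    simp
    field_simp

/-! ### Transport along isometries -/

theorem coordTangent_isometry (L : Space3 ≃ₗᵢ[ℝ] Space3) (c : Space3) (F : Plane2 → Space3)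
    (u : Plane2) (i : Fin 2) :
    coordTangent (fun t => L (F t) + c) u i = L (coordTangent F u i) := by
  have h := L.toContinuousLinearEquiv.comp_fderiv (f := F) (x := u)
  have h' : fderiv ℝ (fun t => L (F t)) u = _ := h
  rw [coordTangent, fderiv_add_const, h']
  rfl

theorem coordSecond_isometry (L : Space3 ≃ₗᵢ[ℝ] Space3) (c : Space3) (F : Plane2 → Space3)
    (u : Plane2) (i j : Fin 2) :
    coordSecond (fun t => L (F t) + c) u i j = L (coordSecond F u i j) := by
  have h1 : (fun v => coordTangent (fun t => L (F t) + c) v j) =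
      fun v => L (coordTangent F v j) + 0 := by
    funext v; rw [coordTangent_isometry, add_zero]
  rw [coordSecond, h1]
  exact coordTangent_isometry L 0 (fun v => coordTangent F v j) u i

theorem mfderiv_isometry {X : M → Space3} (hX : ContMDiff (𝓡 2) (𝓡 3) ∞ X)
    (L : Space3 ≃ₗᵢ[ℝ] Space3) (c : Space3) (p : M) (a : TangentSpace (𝓡 2) p) :
    (mfderiv (𝓡 2) (𝓡 3) (fun q => L (X q) + c) p a : Space3) =
      L (mfderiv (𝓡 2) (𝓡 3) X p a : Space3) := by
  have hL : HasFDerivAt (fun x => L x + c) (L.toContinuousLinearEquiv : Space3 →L[ℝ] Space3)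
      (X p) := L.toContinuousLinearEquiv.hasFDerivAt.add_const c
  have h := hL.hasMFDerivAt.comp p ((hX p).mdifferentiableAt (by simp)).hasMFDerivAt
  have h' : mfderiv (𝓡 2) (𝓡 3) (fun q => L (X q) + c) p = _ := h.mfderiv
  rw [h']
  rfl

theorem IsMinimalImmersion.isometry {X : M → Space3} (hX : IsMinimalImmersion X)
    (L : Space3 ≃ₗᵢ[ℝ] Space3) (c : Space3) : IsMinimalImmersion fun q => L (X q) + c where
  smooth := by
    have h : ContDiff ℝ ∞ fun x => L x + c := L.contDiff.add contDiff_const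
    exact h.contMDiff.comp hX.smooth
  immersion p a b hab := by
    apply hX.immersion p
    apply L.injective
    have h1 := mfderiv_isometry hX.smooth L c p a
    have h2 := mfderiv_isometry hX.smooth L c p b
    exact h1.symm.trans (hab.trans h2)
  minimal e he u hu ν hν := by
    have hcomp : (fun q => L (X q) + c) ∘ e.symm = fun t => L ((X ∘ e.symm) t) + c := rfl
    rw [hcomp] at hν ⊢
    have h1 : IsUnitNormal (X ∘ e.symm) u (L.symm ν) := by
      refine ⟨by rw [L.symm.norm_map]; exact hν.1, fun i => ?_⟩
      have := hν.2 i
      rw [coordTangent_isometry] at this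
      rw [← this, ← L.inner_map_map, L.apply_symm_apply]
    have h2 := hX.minimal e he u hu _ h1
    have h3 : inducedMetric (fun t => L ((X ∘ e.symm) t) + c) u =
        inducedMetric (X ∘ e.symm) u := by
      ext i j
      simp only [inducedMetric, Matrix.of_apply, coordTangent_isometry, L.inner_map_map]
    rw [← h2]
    simp only [meanCurvature, h3, extrinsicCurvature, coordSecond_isometry]
    refine Finset.sum_congr rfl fun i _ => Finset.sum_congr rfl fun j _ => ?_
    rw [← L.inner_map_map (L.symm ν), L.apply_symm_apply]

theorem IsPieceOf.of_isometry {X : M → Space3} {Y : Plane2 → Space3}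
    (L : Space3 ≃ₗᵢ[ℝ] Space3) (c : Space3) (h : IsPieceOf (fun q => L (X q) + c) Y) :
    IsPieceOf X Y := by
  obtain ⟨Φ, hΦ⟩ := h
  refine ⟨Φ.trans (L.toIsometryEquiv.trans (IsometryEquiv.addRight c)).symm, fun p => ?_⟩
  obtain ⟨ψ, hψ, hX⟩ := hΦ p
  refine ⟨ψ, hψ, ?_⟩
  filter_upwards [hX] with q hq
  rw [IsometryEquiv.trans_apply, ← hq]
  exact ((L.toIsometryEquiv.trans (IsometryEquiv.addRight c)).symm_apply_apply (X q)).symm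

end Surfaces

/-! ### Assembly of the classification -/

theorem mainTheorem2 {M : Type*} [TopologicalSpace M] [ConnectedSpace M]
    [ChartedSpace Plane2 M] [IsManifold (𝓡 2) ∞ M]
    (X : M → Space3) (hX : IsMinimalImmersion X)
    (g : ℝ → Space3 → Space3) (hg : IsOneParameterIsometryGroup g)
    (hg_nontrivial : ∃ t x, g t x ≠ x) (hinv : IsInvariantUnder X g) :
    IsPieceOf X planeParam ∨
    (∃ κ : ℝ, 0 < κ ∧ IsPieceOf X (helicoidParam κ)) ∨
    (∃ c : ℝ, 0 < c ∧ IsPieceOf X (catenoidParam c)) ∨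
    (∃ c l : ℝ, 0 < c ∧ 0 < l ∧ l < 1 ∧ IsPieceOf X (scherkParam c l)) := by
  obtain ⟨A, b, hA, ⟨x, hx⟩, hd⟩ := hg.exists_killing_field hg_nontrivial
  have hV := hX.isTangentField hinv hd
  by_cases hA0 : A = 0
  · left
    subst hA0
    simp only [zero_apply, zero_add] at hV hx
    exact isPieceOf_planeParam_of_translation hX hx hV
  obtain ⟨L, c, a, h, ha, hh, hL⟩ := exists_screw_normal_form b hA hA0
  have hX' := hX.isometry L c
  have hV' : IsTangentField (fun q => L (X q) + c) (screwField h) := by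
    intro q
    obtain ⟨v, hv⟩ := hV q
    -- Tangency is unaffected by the nonzero factor a in the normal form.
    refine ⟨a⁻¹ • v, ?_⟩
    have h1 := mfderiv_isometry hX.smooth L c q v
    rw [hv, hL] at h1
    rw [map_smul]
    refine (congrArg (fun y : Space3 => a⁻¹ • y) h1).trans ?_
    rw [smul_smul, inv_mul_cancel₀ ha, one_smul]
  rcases isPieceOf_planeParam_or_screwParam hX' hV' with hp | ⟨β, d, hβ, hne, hS⟩
  · exact Or.inl (hp.of_isometry L c)
  · right
    rcases isPieceOf_of_screwParam hh hβ hne hS with ⟨κ, h1, h2⟩ | ⟨r, h1, h2⟩ |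
      ⟨r, l, h1, h2, h3, h4⟩
    · exact Or.inl ⟨κ, h1, h2.of_isometry L c⟩
    · exact Or.inr (Or.inl ⟨r, h1, h2.of_isometry L c⟩)
    · exact Or.inr (Or.inr ⟨r, l, h1, h2, h3, h4.of_isometry L c⟩)
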